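/- Let $2\le m<n$ be integers, let $r\in\{2,3,\dots\}\cup\{\infty\}$, and let $\Omega\subset\mathbb R^n$ be a domain (a nonempty connected open set) with boundary $M=b\Omega$ of class $\mathscr C^r$. For an open set $D\subset\mathbb R^n$ with $\mathscr C^2$ boundary near $p\in bD$, let $\nu_1(p)\le\nu_2(p)\le\dots\le\nu_{n-1}(p)$ be the principal curvatures of $bD$ at $p$ from the inner side (so they are positive on the boundary of a ball). The hypersurface $bD$ is $m$-convex (resp. strongly $m$-convex) at $p$ if $\nu_1(p)+\dots+\nu_m(p)\ge0$ (resp. $>0$), the point $p$ is $m$-flat if $\nu_1(p)=\dots=\nu_m(p)=0$, and $bD$ is not $m$-flat at infinity if the set of its $m$-flat points has bounded relative interior in $bD$. Assume that $M$ is $m$-convex at every point, that $M$ is not $m$-flat at infinity, and that for some $\epsilon>0$ every point of the $\epsilon$-neighbourhood $\{x:\mathrm{dist}(x,M)<\epsilon\}$ has a unique nearest point in $M$. Let $\delta_M$ be the signed distance function to $M$, that is, $\delta_M(x)=-\mathrm{dist}(x,M)$ for $x\in\Omega$ and $\delta_M(x)=\mathrm{dist}(x,M)$ for $x\in\mathbb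 R^n\setminus\Omega$. Then there is a function $\rho:\overline\Omega\to(-\infty,0]$ of class $\mathscr C^r(\overline\Omega)$ (that is, extending to a $\mathscr C^r$ function on a neighbourhood of $\overline\Omega$) such that: 1. $\rho$ is $m$-plurisubharmonic on $\Omega$: for every $x\in\Omega$ and every $m$-dimensional linear subspace $\Lambda\subset\mathbb R^n$, the trace of the restriction to $\Lambda$ of the Hessian form of $\rho$ at $x$ is nonnegative; 2. $\rho=0$ on $M$; 3. $d\rho\ne0$ at every point of $\rho^{-1}((-1,0])$; 4. for every $t\in(-1,0)$ the level set $M_t=\{x\in\overline\Omega:\rho(x)=t\}$ equals the level set $\{\delta_M=\tau\}$ for some $\tau=\tau(t)\in(-\epsilon,0)$, and it is the boundary of $\{x\in\Omega:\rho(x)<t\}$; oriented as this boundary (with principal curvatures taken from the side $\rho<t$), $M_t$ is $m$-convex at every point, strongly $m$-convex at every point that is not $m$-flat, and not $m$-flat at infinity. -/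

import Mathlib

open Set Topology Metric

noncomputable section

namespace MConvex

/-- The second derivative of `f` at `x` as a bilinear form:
`hess f x v w` is `∑ i j, ∂²f/∂x_i∂x_j (x) * v_i * w_j` when `f` is `C²` near `x`. -/
def hess {n : ℕ} (f : EuclideanSpace ℝ (Fin n) → ℝ) (x v w : EuclideanSpace ℝ (Fin n)) : ℝ :=
  fderiv ℝ (fderiv ℝ f) x v w

/-- The trace of the restriction of the Hessian form of `f` at `x` to the linear subspace `L`,
computed in an orthonormal basis of `L`. -/
def traceHess {n : ℕ} (f : EuclideanSpace ℝ (Fin n) → ℝ) (x : EuclideanSpace ℝ (Fin n))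
    (L : Submodule ℝ (EuclideanSpace ℝ (Fin n))) : ℝ :=
  ∑ i, hess f x (stdOrthonormalBasis ℝ L i) (stdOrthonormalBasis ℝ L i)

/-- `f` is an `m`-plurisubharmonic function (of class `C²`) on the open set `Ω`: the trace of its
Hessian on every `m`-dimensional linear subspace is nonnegative at every point of `Ω`. -/
def IsMPlurisubharmonicOn {n : ℕ} (m : ℕ) (f : EuclideanSpace ℝ (Fin n) → ℝ)
    (Ω : Set (EuclideanSpace ℝ (Fin n))) : Prop :=
  ContDiffOn ℝ 2 f Ω ∧
    ∀ x ∈ Ω, ∀ L : Submodule ℝ (EuclideanSpace ℝ (Fin n)), Module.finrank ℝ L = m →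
      0 ≤ traceHess f x L

/-- `φ` is a defining function of class `C^r` of the set `D` on the open neighbourhood `U` of the
boundary point `p`: `D ∩ U = {φ < 0}`, `φ p = 0`, and `dφ ≠ 0` on `U`.
(Hence `frontier D ∩ U = {φ = 0}`.) -/
structure IsLocalDefiningFunction {n : ℕ} (r : WithTop ℕ∞) (D : Set (EuclideanSpace ℝ (Fin n)))
    (p : EuclideanSpace ℝ (Fin n)) (U : Set (EuclideanSpace ℝ (Fin n)))
    (φ : EuclideanSpace ℝ (Fin n) → ℝ) : Prop where
  isOpen : IsOpen U
  mem : p ∈ U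
  contDiffOn : ContDiffOn ℝ r φ U
  neg_iff : ∀ x ∈ U, (x ∈ D ↔ φ x < 0)
  zero : φ p = 0
  fderiv_ne_zero : ∀ x ∈ U, fderiv ℝ φ x ≠ 0

/-- The boundary of `Ω` is of class `C^r`. -/
def HasBoundaryOfClass {n : ℕ} (r : WithTop ℕ∞) (Ω : Set (EuclideanSpace ℝ (Fin n))) : Prop :=
  ∀ p ∈ frontier Ω, ∃ U φ, IsLocalDefiningFunction r Ω p U φ

/-- The second fundamental form at `p` of the level set of `φ` through `p`, with respect to the
side `{φ < φ p}`. On vectors tangent to the level set it is `⟪dN_p v, w⟫`, where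
`N = ∇φ / |∇φ|` is the unit normal pointing out of that side; so it is positive definite for
spheres seen from the inside. -/
def secondFundamentalForm {n : ℕ} (φ : EuclideanSpace ℝ (Fin n) → ℝ)
    (p v w : EuclideanSpace ℝ (Fin n)) : ℝ :=
  hess φ p v w / ‖fderiv ℝ φ p‖

/-- `ν 0 ≤ ν 1 ≤ ⋯ ≤ ν (n - 2)` are the principal curvatures, from the side of `D`, of the `C²`
hypersurface `frontier D` at its point `p`: the second fundamental form is diagonal with entries
`ν j` in some orthonormal basis `v` of the tangent space `ker dφ_p`. -/
def IsPrincipalCurvatures {n : ℕ} (D : Set (EuclideanSpace ℝ (Fin n)))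
    (p : EuclideanSpace ℝ (Fin n)) (ν : Fin (n - 1) → ℝ) : Prop :=
  Monotone ν ∧
    ∃ U φ, IsLocalDefiningFunction 2 D p U φ ∧
      ∃ v : Fin (n - 1) → EuclideanSpace ℝ (Fin n),
        Orthonormal ℝ v ∧ (∀ i, fderiv ℝ φ p (v i) = 0) ∧
          ∀ i j, secondFundamentalForm φ p (v i) (v j) = if i = j then ν i else 0

/-- The hypersurface `frontier D`, oriented as the boundary of `D`, is `m`-convex at `p`:
the sum of its `m` smallest principal curvatures is nonnegative. -/
def IsMConvexAt {n : ℕ} (m : ℕ) (D : Set (EuclideanSpace ℝ (Fin n)))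
    (p : EuclideanSpace ℝ (Fin n)) : Prop :=
  ∃ ν, IsPrincipalCurvatures D p ν ∧
    0 ≤ ∑ j ∈ Finset.univ.filter (fun j : Fin (n - 1) => (j : ℕ) < m), ν j

/-- The hypersurface `frontier D` is strongly `m`-convex at `p`. -/
def IsStronglyMConvexAt {n : ℕ} (m : ℕ) (D : Set (EuclideanSpace ℝ (Fin n)))
    (p : EuclideanSpace ℝ (Fin n)) : Prop :=
  ∃ ν, IsPrincipalCurvatures D p ν ∧
    0 < ∑ j ∈ Finset.univ.filter (fun j : Fin (n - 1) => (j : ℕ) < m), ν j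

/-- `p` is an `m`-flat point of the hypersurface `frontier D`: its `m` smallest principal
curvatures vanish. -/
def IsMFlatAt {n : ℕ} (m : ℕ) (D : Set (EuclideanSpace ℝ (Fin n)))
    (p : EuclideanSpace ℝ (Fin n)) : Prop :=
  ∃ ν, IsPrincipalCurvatures D p ν ∧ ∀ j : Fin (n - 1), (j : ℕ) < m → ν j = 0

/-- The hypersurface `frontier D` is not `m`-flat at infinity: the interior, relative to
`frontier D`, of the set of its `m`-flat points is bounded. -/
def NotMFlatAtInfinity {n : ℕ} (m : ℕ) (D : Set (EuclideanSpace ℝ (Fin n))) : Prop :=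
  Bornology.IsBounded
    (Subtype.val '' interior {p : ↥(frontier D) | IsMFlatAt m D (p : EuclideanSpace ℝ (Fin n))})

/-- Every point of the `ε`-neighbourhood of `M` has a unique nearest point in `M`. -/
def HasUniqueNearestPoints {n : ℕ} (ε : ℝ) (M : Set (EuclideanSpace ℝ (Fin n))) : Prop :=
  ∀ x ∈ thickening ε M, ∃! p, p ∈ M ∧ dist x p = infDist x M

open Classical in
/-- The signed distance function to the boundary of `Ω`, negative on `Ω`. -/
def signedDistance {n : ℕ} (Ω : Set (EuclideanSpace ℝ (Fin n)))
    (x : EuclideanSpace ℝ (Fin n)) : ℝ :=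
  if x ∈ Ω then -infDist x (frontier Ω) else infDist x (frontier Ω)

end MConvex

end

/-! The function is `ρ = g ∘ δ`, where `δ` is the signed distance to `M` and `g` is a smooth
function that equals `-1` on `(-∞, -c]`, increases to `g 0 = 0`, and is so convex that `g'' ≥ C g'`
on `(-∞, 0]`.

Uniqueness of nearest points within `ε` forces every inner normal segment of length less than `ε` to
realize the distance to `M` (`infDist_sub_smul_unitNormal`). So `M` is touched from inside by balls
of every radius below `ε`: there are no focal points in the inner tube, and the inverse function
theorem makes the foot-point map `C^(r-1)`. As `∇δ` is the normal at the foot point, `δ` itself is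
`C^r` (`exists_contDiffOn_signedDistance`).

Since `∇δ` is constant along normals, differentiation gives a Riccati relation
(`IsTube.shapeOperator_add_smul`): a principal curvature `ν` of `M` becomes `ν / (1 + tν)` on `{δ =
t}`, `-ε < t < 0`. This map is increasing, fixes `0`, and raises every `ν ≠ 0`. Hence the inner
parallel hypersurfaces are `m`-convex, strongly so off their `m`-flat points, and these lie over
`m`-flat points of `M`.

For an `m`-plane `L` with orthonormal basis `e_i`, the trace of `Hess δ` on `L` is at least `-C ∑
dδ(e_i)²`, where `C ≥ 0` bounds the curvatures from above (`IsTube.neg_mul_le_traceHess`): only the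
normal component of `L` costs anything. Down to depth `ε / 2` one can take `C = 2 / ε`. In the trace
of `Hess ρ`, the term `g'' ∑ dδ(e_i)²` compensates this loss. -/

namespace MConvex

/-! ### Nearest points and normal segments when nearest points are unique -/

section Nearest

variable {E : Type*} [NormedAddCommGroup E] [InnerProductSpace ℝ E] [FiniteDimensional ℝ E]

open scoped RealInnerProductSpace

/-- Nearest points to `x` are close to the unique nearest point of `x₀` when `x` is close
to `x₀`. -/
theorem eventually_nearest_mem {M : Set E} (hM : IsClosed M) {x₀ p₀ : E}
    (hp₀ : p₀ ∈ M) (huniq : ∀ q ∈ M, dist x₀ q = infDist x₀ M → q = p₀)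
    {U : Set E} (hU : U ∈ 𝓝 p₀) :
    ∀ᶠ x in 𝓝 x₀, ∀ q ∈ M, dist x q = infDist x M → q ∈ U := by
  have : ProperSpace E := FiniteDimensional.proper_real E
  have hne : M.Nonempty := ⟨p₀, hp₀⟩
  -- Off `U`, compactness gives a margin `2 * η` over the minimal distance. The radius `+ 2`
  -- suffices to contain every nearest point of an `x` within distance `1` of `x₀`.
  set K : Set E := (M \ interior U) ∩ closedBall x₀ (infDist x₀ M + 2) with hK
  have hKc : IsCompact K :=
    (isCompact_closedBall _ _).inter_left (hM.sdiff isOpen_interior)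
  obtain ⟨η, hη, hηK⟩ : ∃ η > 0, ∀ q ∈ K, infDist x₀ M + 2 * η ≤ dist x₀ q := by
    rcases K.eq_empty_or_nonempty with hKe | hKn
    · exact ⟨1, one_pos, by simp [hKe]⟩
    · obtain ⟨q, hq, hmin⟩ := hKc.exists_isMinOn hKn
        (Continuous.continuousOn (f := fun q => dist x₀ q) (by fun_prop))
      have h1 : infDist x₀ M ≤ dist x₀ q := infDist_le_dist_of_mem hq.1.1
      have h2 : infDist x₀ M ≠ dist x₀ q := fun h => hq.1.2 (by
        rw [huniq q hq.1.1 h.symm]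
        exact mem_interior_iff_mem_nhds.2 hU)
      refine ⟨(dist x₀ q - infDist x₀ M) / 2, by have := lt_of_le_of_ne h1 h2; linarith, ?_⟩
      intro y hy
      have := hmin hy
      simp only [mem_ofPred_eq] at this
      linarith
  filter_upwards [ball_mem_nhds x₀ (lt_min hη one_pos)] with x hx q hq hqd
  rw [mem_ball, lt_min_iff] at hx
  have h1 : infDist x M ≤ infDist x₀ M + dist x x₀ := infDist_le_infDist_add_dist
  have h2 : dist x₀ q ≤ dist x x₀ + dist x q := dist_triangle_left _ _ _
  by_contra hqU
  have hqK : q ∈ K := by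
    refine ⟨⟨hq, fun h => hqU (interior_subset h)⟩, ?_⟩
    rw [mem_closedBall, dist_comm]
    linarith
  have := hηK q hqK
  linarith

/-- The distance function grows at almost unit speed in the direction away from the unique
nearest point. -/
theorem eventually_infDist_ascent {M : Set E} (hM : IsClosed M) {y p : E}
    (hp : p ∈ M) (hpd : dist y p = infDist y M) (hpos : 0 < infDist y M)
    (huniq : ∀ q ∈ M, dist y q = infDist y M → q = p) {κ : ℝ} (hκ : κ < 1) :
    ∀ᶠ h in 𝓝[>] (0 : ℝ), infDist y M + κ * h ≤ infDist (y + h • (‖y - p‖⁻¹ • (y - p))) M := by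
  have : ProperSpace E := FiniteDimensional.proper_real E
  have hyp : 0 < ‖y - p‖ := by rw [← dist_eq_norm, hpd]; exact hpos
  set u := ‖y - p‖⁻¹ • (y - p) with hu
  -- A nearest point `q` of `y + h • u` is close to `p`, so `y - q` makes a small angle with `u`;
  -- Cauchy–Schwarz for `y + h • u - q` and `y - q` then gives the growth rate `κ`.
  have hU : {q : E | κ * ‖y - q‖ < ⟪u, y - q⟫} ∈ 𝓝 p := by
    refine (isOpen_lt (by fun_prop) (by fun_prop)).mem_nhds ?_
    change κ * ‖y - p‖ < ⟪u, y - p⟫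
    simp only [hu, real_inner_smul_left, real_inner_self_eq_norm_sq]
    rw [show ‖y - p‖⁻¹ * ‖y - p‖ ^ 2 = ‖y - p‖ by field_simp]
    nlinarith
  have hev := eventually_nearest_mem hM hp huniq hU
  have hcont : Filter.Tendsto (fun h : ℝ => y + h • u) (𝓝[>] 0) (𝓝 y) := by
    have : Continuous (fun h : ℝ => y + h • u) := by fun_prop
    have h := this.tendsto 0
    simp only [zero_smul, add_zero] at h
    exact h.mono_left nhdsWithin_le_nhds
  filter_upwards [hcont.eventually hev, self_mem_nhdsWithin] with h hh hpos'
  obtain ⟨q, hq, hqd⟩ := hM.exists_infDist_eq_dist ⟨p, hp⟩ (y + h • u)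
  have hqU := hh q hq hqd.symm
  replace hqU : κ * ‖y - q‖ < ⟪u, y - q⟫ := hqU
  rw [hqd, dist_eq_norm]
  have h1 : infDist y M ≤ ‖y - q‖ := by rw [← dist_eq_norm]; exact infDist_le_dist_of_mem hq
  have hyq : 0 < ‖y - q‖ := lt_of_lt_of_le hpos h1
  have h2 : ⟪y + h • u - q, y - q⟫ ≤ ‖y + h • u - q‖ * ‖y - q‖ := real_inner_le_norm _ _
  have h3 : ⟪y + h • u - q, y - q⟫ = ‖y - q‖ ^ 2 + h * ⟪u, y - q⟫ := by
    rw [show y + h • u - q = (y - q) + h • u by abel, inner_add_left, real_inner_smul_left,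
      real_inner_self_eq_norm_sq]
  have h4 : h * (κ * ‖y - q‖) ≤ h * ⟪u, y - q⟫ :=
    mul_le_mul_of_nonneg_left hqU.le (le_of_lt hpos')
  have h5 : ‖y - q‖ + κ * h ≤ ‖y + h • u - q‖ := by
    refine le_of_mul_le_mul_right ?_ hyq
    nlinarith
  linarith

/-- Maximize the distance to `M` among points of the ball reached from `x` with average growth at
least `κ`. A maximizer inside the open ball could be pushed further by `eventually_infDist_ascent`
without leaving this set, so it lies on the sphere. -/
theorem exists_mem_sphere_infDist_ge {M : Set E} (hM : IsClosed M) {ε : ℝ}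
    (huniq : ∀ x, infDist x M < ε → ∃! p, p ∈ M ∧ dist x p = infDist x M)
    {x : E} (hx : 0 < infDist x M) {η : ℝ} (hη : 0 ≤ η) (hxη : infDist x M + η < ε)
    {κ : ℝ} (hκ0 : 0 < κ) (hκ : κ < 1) :
    ∃ z ∈ sphere x η, infDist x M + κ * η ≤ infDist z M := by
  have : ProperSpace E := FiniteDimensional.proper_real E
  have hcont : Continuous (fun z : E => infDist z M) := continuous_infDist_pt M
  set A : Set E := closedBall x η ∩ {z | infDist x M + κ * dist z x ≤ infDist z M} with hA
  have hAc : IsCompact A := (isCompact_closedBall _ _).inter_right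
    (isClosed_le (by fun_prop) hcont)
  obtain ⟨z, hz, hmax⟩ := hAc.exists_isMaxOn
    (⟨x, mem_closedBall_self hη, by simp⟩ : A.Nonempty) hcont.continuousOn
  suffices hzη : dist z x = η by
    refine ⟨z, hzη, ?_⟩
    have hz2 : infDist x M + κ * dist z x ≤ infDist z M := hz.2
    rwa [hzη] at hz2
  · by_contra hne'
    have hlt : dist z x < η := lt_of_le_of_ne hz.1 hne'
    have hz2 : infDist x M + κ * dist z x ≤ infDist z M := hz.2
    have hzpos : 0 < infDist z M := by nlinarith [dist_nonneg (x := z) (y := x)]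
    have hzε : infDist z M < ε := by
      have : infDist z M ≤ infDist x M + dist z x := infDist_le_infDist_add_dist
      linarith
    obtain ⟨p, ⟨hp, hpd⟩, hpu⟩ := huniq z hzε
    have hasc := eventually_infDist_ascent hM hp hpd hzpos (fun q h1 h2 => hpu q ⟨h1, h2⟩) hκ
    have hsm : ∀ᶠ h in 𝓝[>] (0 : ℝ), h < η - dist z x :=
      nhdsWithin_le_nhds (Iio_mem_nhds (by linarith))
    obtain ⟨h, h1, h2, h3⟩ := (hasc.and (hsm.and self_mem_nhdsWithin)).exists
    have h3 : 0 < h := h3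
    set u := ‖z - p‖⁻¹ • (z - p)
    have hun : ‖u‖ = 1 := by
      have : 0 < ‖z - p‖ := by rw [← dist_eq_norm, hpd]; exact hzpos
      simp [u, norm_smul, this.ne']
    have hd : dist (z + h • u) z = h := by
      simp [dist_eq_norm, norm_smul, hun, abs_of_pos h3]
    have htri : dist (z + h • u) x ≤ h + dist z x := by
      have := dist_triangle (z + h • u) z x
      rwa [hd] at this
    have hmem : z + h • u ∈ A := by
      refine ⟨by rw [mem_closedBall]; linarith, ?_⟩
      simp only [mem_ofPred_eq]
      nlinarith
    have := hmax hmem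
    simp only [mem_ofPred_eq] at this
    nlinarith

/-- In the region where nearest points are unique, the distance function attains the largest value
permitted by its Lipschitz constant on every small sphere. -/
theorem exists_mem_sphere_infDist_eq {M : Set E} (hM : IsClosed M) {ε : ℝ}
    (huniq : ∀ x, infDist x M < ε → ∃! p, p ∈ M ∧ dist x p = infDist x M)
    {x : E} (hx : 0 < infDist x M) {η : ℝ} (hη : 0 ≤ η) (hxη : infDist x M + η < ε) :
    ∃ z ∈ sphere x η, infDist z M = infDist x M + η := by
  have : ProperSpace E := FiniteDimensional.proper_real E
  have hcont : Continuous (fun z : E => infDist z M) := continuous_infDist_pt M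
  obtain ⟨z₀, hz₀, -⟩ := exists_mem_sphere_infDist_ge hM huniq hx hη hxη
    (κ := 1 / 2) (by norm_num) (by norm_num)
  -- The maximizer on the sphere does not depend on `κ`, so `κ` can tend to `1` with `z` fixed.
  obtain ⟨z, hz, hmax⟩ := (isCompact_sphere x η).exists_isMaxOn ⟨z₀, hz₀⟩ hcont.continuousOn
  refine ⟨z, hz, le_antisymm ?_ ?_⟩
  · have : infDist z M ≤ infDist x M + dist z x := infDist_le_infDist_add_dist
    rwa [mem_sphere.1 hz] at this
  · have hlim : Filter.Tendsto (fun κ : ℝ => infDist x M + κ * η) (𝓝[<] 1)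
        (𝓝 (infDist x M + 1 * η)) :=
      (Continuous.tendsto (by fun_prop) 1).mono_left nhdsWithin_le_nhds
    rw [one_mul] at hlim
    refine le_of_tendsto hlim ?_
    filter_upwards [Ioo_mem_nhdsLT (zero_lt_one' ℝ)] with κ hκ
    obtain ⟨y, hy, hyd⟩ := exists_mem_sphere_infDist_ge hM huniq hx hη hxη hκ.1 hκ.2
    exact hyd.trans (hmax hy)

/-- Moving away from the nearest point along the segment which realizes the distance, the nearest
point does not change as long as one stays in the region where nearest points are unique. -/
theorem infDist_add_smul_of_nearest {M : Set E} (hM : IsClosed M) {ε : ℝ}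
    (huniq : ∀ x, infDist x M < ε → ∃! p, p ∈ M ∧ dist x p = infDist x M)
    {x p u : E} (hp : p ∈ M) (hu : ‖u‖ = 1) (hxu : x = p + infDist x M • u)
    (hx : 0 < infDist x M) {s : ℝ} (hs : 0 ≤ s) (hsε : s < ε) :
    infDist (p + s • u) M = s := by
  rcases le_total s (infDist x M) with h | h
  · refine le_antisymm ?_ ?_
    · refine (infDist_le_dist_of_mem hp).trans ?_
      simp [dist_eq_norm, norm_smul, hu, abs_of_nonneg hs]
    · have h1 : infDist x M ≤ infDist (p + s • u) M + dist x (p + s • u) :=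
        infDist_le_infDist_add_dist
      have h2 : dist x (p + s • u) = infDist x M - s := by
        nth_rewrite 1 [hxu]
        rw [dist_eq_norm, add_sub_add_left_eq_sub, ← sub_smul, norm_smul, hu, mul_one,
          Real.norm_of_nonneg (by linarith)]
      linarith
  · obtain ⟨z, hz, hzd⟩ := exists_mem_sphere_infDist_eq hM huniq hx
      (η := s - infDist x M) (by linarith) (by linarith)
    have hzd : infDist z M = s := by rw [hzd]; ring
    have hxz : ‖z - x‖ = s - infDist x M := by rw [← dist_eq_norm]; exact hz
    have hxp : x - p = infDist x M • u := by nth_rewrite 1 [hxu]; abel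
    -- Since `‖z - x‖ + ‖x - p‖ = s`, this is equality in the triangle inequality, which puts `z` on
    -- the ray from `p` through `x`.
    have hzp : s ≤ ‖z - p‖ := by
      rw [← hzd, ← dist_eq_norm]; exact infDist_le_dist_of_mem hp
    have hinner : ⟪z - x, u⟫ ≤ ‖z - x‖ * ‖u‖ := real_inner_le_norm _ _
    have hsplit : ‖z - p‖ ^ 2 = ‖z - x‖ ^ 2 + 2 * (infDist x M * ⟪z - x, u⟫) + infDist x M ^ 2 := by
      rw [show z - p = (z - x) + infDist x M • u by rw [← hxp]; abel, norm_add_sq_real,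
        real_inner_smul_right, norm_smul, hu, mul_one, Real.norm_of_nonneg hx.le]
    have heq : ⟪z - x, u⟫ = ‖z - x‖ * ‖u‖ := by
      refine le_antisymm hinner ?_
      rw [hu, mul_one]
      refine le_of_mul_le_mul_left ?_ hx
      nlinarith [mul_self_le_mul_self hs hzp]
    have hzx : z - x = (s - infDist x M) • u := by
      have := inner_eq_norm_mul_iff_real.1 heq
      rw [hu, one_smul, hxz] at this
      exact this
    have : p + s • u = z := by
      have h1 : z - p = s • u := by
        rw [← sub_add_sub_cancel z x p, hzx, hxp, ← add_smul, sub_add_cancel]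
      rw [← h1, add_sub_cancel]
    rw [this, hzd]

end Nearest

/-! ### Riesz representation of differentials -/

section Sharp

variable {E : Type*} [NormedAddCommGroup E] [InnerProductSpace ℝ E] [CompleteSpace E]

open scoped RealInnerProductSpace

/-- The vector representing a continuous linear functional on a real Hilbert space, as a
continuous linear map. -/
noncomputable def sharp : StrongDual ℝ E →L[ℝ] E :=
  LinearMap.mkContinuous
    { toFun := fun g => (InnerProductSpace.toDual ℝ E).symm g
      map_add' := fun g h => map_add _ g h
      map_smul' := fun c g => by simp } 1 (fun g => by simp)

@[simp]
theorem inner_sharp (g : StrongDual ℝ E) (v : E) : ⟪sharp g, v⟫ = g v :=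
  InnerProductSpace.toDual_symm_apply

@[simp]
theorem inner_sharp_right (g : StrongDual ℝ E) (v : E) : ⟪v, sharp g⟫ = g v := by
  rw [real_inner_comm, inner_sharp]

@[simp]
theorem norm_sharp (g : StrongDual ℝ E) : ‖sharp g‖ = ‖g‖ :=
  (InnerProductSpace.toDual ℝ E).symm.norm_map g

theorem apply_sharp_self (g : StrongDual ℝ E) : g (sharp g) = ‖g‖ ^ 2 := by
  rw [← inner_sharp, real_inner_self_eq_norm_sq, norm_sharp]

/-- A functional which is nonpositive on an open half space is a nonpositive multiple of the
normal vector of the half space. -/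
theorem norm_smul_sharp_eq_of_nonpos {g : StrongDual ℝ E} {a : E}
    (h : ∀ w, 0 < ⟪a, w⟫ → g w ≤ 0) : ‖a‖ • sharp g = -(‖g‖ • a) := by
  have key : ⟪a, -sharp g⟫ = ‖a‖ * ‖-sharp g‖ := by
    refine le_antisymm (real_inner_le_norm _ _) ?_
    by_contra hlt
    push Not at hlt
    rw [inner_neg_right, norm_neg, norm_sharp, inner_sharp_right] at hlt
    have ha : 0 < ‖a‖ := by
      refine (norm_nonneg a).lt_of_ne' fun h0 => ?_
      rw [h0, norm_eq_zero.1 h0] at hlt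
      simp at hlt
    have hg : 0 < ‖g‖ := by
      refine (norm_nonneg g).lt_of_ne' fun h0 => ?_
      rw [h0, norm_eq_zero.1 h0] at hlt
      simp at hlt
    -- The test vector bisects the angle between `a` and `sharp g`; unless they are opposite, both
    -- functionals are positive on it.
    have h1 := h (‖g‖ • a + ‖a‖ • sharp g) (by
      rw [inner_add_right, real_inner_smul_right, real_inner_smul_right,
        real_inner_self_eq_norm_sq, inner_sharp_right]
      nlinarith)
    rw [map_add, map_smul, map_smul, apply_sharp_self, smul_eq_mul, smul_eq_mul] at h1
    nlinarith
  have := inner_eq_norm_mul_iff_real.1 key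
  rw [norm_neg, norm_sharp, smul_neg] at this
  rw [this, neg_neg]

end Sharp

/-! ### Second-order behaviour along parabolas -/

section SecondOrder

variable {E : Type*} [NormedAddCommGroup E] [NormedSpace ℝ E]

/-- Sign of a function along a parabola which is tangent to its zero set. -/
theorem eventually_neg_along_parabola {φ : E → ℝ} {p v w : E} (hφ : ContDiffAt ℝ 2 φ p)
    (hp : φ p = 0) (hv : fderiv ℝ φ p v = 0)
    (hneg : fderiv ℝ φ p w + fderiv ℝ (fderiv ℝ φ) p v v / 2 < 0) :
    ∀ᶠ s in 𝓝[>] (0 : ℝ), φ (p + s • v + s ^ 2 • w) < 0 := by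
  set γ : ℝ → E := fun s => p + s • v + s ^ 2 • w with hγ
  have hγ0 : γ 0 = p := by simp [hγ]
  have hγd : ∀ s, HasDerivAt γ (v + (2 * s) • w) s := by
    intro s
    have h1 := ((hasDerivAt_id s).smul_const v).const_add p
    have h2 := (hasDerivAt_pow 2 s).smul_const w
    have := h1.add h2
    simp only [one_smul, Nat.cast_ofNat, Nat.add_one_sub_one, pow_one] at this
    exact this
  have hγc : Filter.Tendsto γ (𝓝 0) (𝓝 p) := by
    have := (hγd 0).continuousAt.tendsto
    rwa [hγ0] at this
  have hev : ∀ᶠ s in 𝓝 (0 : ℝ),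
      HasDerivAt (fun s => φ (γ s)) (fderiv ℝ φ (γ s) (v + (2 * s) • w)) s := by
    have h1 : ∀ᶠ x in 𝓝 p, ContDiffAt ℝ 2 φ x := hφ.eventually (by simp)
    filter_upwards [hγc.eventually h1] with s hs
    exact ((hs.differentiableAt (by norm_num)).hasFDerivAt).comp_hasDerivAt s (hγd s)
  have hd2 : HasFDerivAt (fderiv ℝ φ) (fderiv ℝ (fderiv ℝ φ) p) (γ 0) := by
    rw [hγ0]
    exact ((hφ.fderiv_right (m := 1) (by norm_num)).differentiableAt (by norm_num)).hasFDerivAt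
  -- The derivative of `φ ∘ γ` vanishes at `0`, and its own derivative there is twice the quantity
  -- in `hneg`; so it is negative just to the right of `0`.
  have hf' : HasDerivAt (fun s => fderiv ℝ φ (γ s) (v + (2 * s) • w))
      (fderiv ℝ (fderiv ℝ φ) p v v + fderiv ℝ φ p ((2 : ℝ) • w)) 0 := by
    have h1 := hd2.comp_hasDerivAt (0 : ℝ) (hγd 0)
    have h2 : HasDerivAt (fun s : ℝ => v + (2 * s) • w) ((2 : ℝ) • w) 0 := by
      have := (((hasDerivAt_id (0 : ℝ)).const_mul 2).smul_const w).const_add v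
      simpa using this
    have := h1.clm_apply h2
    simpa [hγ0] using this
  have hslope := hasDerivAt_iff_tendsto_slope.1 hf'
  have hneg' : fderiv ℝ (fderiv ℝ φ) p v v + fderiv ℝ φ p ((2 : ℝ) • w) < 0 := by
    rw [map_smul, smul_eq_mul]; linarith
  have hf'neg : ∀ᶠ s in 𝓝[>] (0 : ℝ), fderiv ℝ φ (γ s) (v + (2 * s) • w) < 0 := by
    have h1 := (hslope.mono_left (nhdsWithin_mono 0
      (fun s (hs : 0 < s) => hs.ne') : 𝓝[>] (0 : ℝ) ≤ 𝓝[≠] 0)).eventually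
        (gt_mem_nhds hneg')
    filter_upwards [h1, self_mem_nhdsWithin] with s hs hs0
    have hs0 : 0 < s := hs0
    rw [slope_def_field] at hs
    simp only [hγ0, mul_zero, zero_smul, add_zero, hv, sub_zero] at hs
    rwa [div_neg_iff, or_iff_right (by intro h; linarith [h.2]), and_iff_left hs0] at hs
  obtain ⟨r, hr, hball⟩ := Metric.eventually_nhds_iff.1 hev
  obtain ⟨r', hr', hball'⟩ := mem_nhdsGT_iff_exists_Ioo_subset.1 hf'neg
  have hr' : 0 < r' := hr'
  have hm : 0 < min r r' := lt_min hr hr'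
  have hanti : StrictAntiOn (fun s => φ (γ s)) (Ico 0 (min r r')) := by
    refine strictAntiOn_of_deriv_neg (convex_Ico _ _) ?_ ?_
    · intro s hs
      refine (hball (y := s) ?_).continuousAt.continuousWithinAt
      rw [Real.dist_eq, sub_zero, abs_of_nonneg hs.1]
      exact hs.2.trans_le (min_le_left _ _)
    · intro s hs
      rw [interior_Ico] at hs
      rw [(hball (y := s) ?_).deriv]
      · exact hball' ⟨hs.1, hs.2.trans_le (min_le_right _ _)⟩
      · rw [Real.dist_eq, sub_zero, abs_of_pos hs.1]
        exact hs.2.trans_le (min_le_left _ _)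
  filter_upwards [Ioo_mem_nhdsGT hm] with s hs
  have := hanti (left_mem_Ico.2 hm) ⟨hs.1.le, hs.2⟩ hs.1
  simpa only [hγ0, hp] using this

theorem eventually_pos_along_parabola {φ : E → ℝ} {p v w : E} (hφ : ContDiffAt ℝ 2 φ p)
    (hp : φ p = 0) (hv : fderiv ℝ φ p v = 0)
    (hpos : 0 < fderiv ℝ φ p w + fderiv ℝ (fderiv ℝ φ) p v v / 2) :
    ∀ᶠ s in 𝓝[>] (0 : ℝ), 0 < φ (p + s • v + s ^ 2 • w) := by
  have h1 : fderiv ℝ (fun x => -φ x) = fun x => -fderiv ℝ φ x := by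
    funext x; exact fderiv_fun_neg
  have := eventually_neg_along_parabola (φ := fun x => -φ x) (v := v) (w := w) hφ.neg
    (by simp [hp]) (by simp [hv]) (by
      rw [h1, fderiv_fun_neg]
      simp only [neg_apply]
      linarith)
  simpa using this

theorem tendsto_parabola (p v w : E) :
    Filter.Tendsto (fun s : ℝ => p + s • v + s ^ 2 • w) (𝓝[>] 0) (𝓝 p) := by
  have h : Continuous (fun s : ℝ => p + s • v + s ^ 2 • w) := by fun_prop
  have := h.tendsto 0
  simp only [zero_smul, add_zero, ne_eq, OfNat.ofNat_ne_zero, not_false_eq_true, zero_pow] at this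
  exact this.mono_left nhdsWithin_le_nhds

end SecondOrder

/-! ### Normal and second fundamental form depend only on the domain -/

section DefiningFunctions

open scoped RealInnerProductSpace

/-- The squared distance to `c` along the parabola is `‖c - p‖² + s² (‖v‖² - 2⟪c - p, w⟫) + O(s³)`.
-/
theorem eventually_parabola_mem_ball {E : Type*} [NormedAddCommGroup E] [InnerProductSpace ℝ E]
    {c p v w : E} (hv : ⟪c - p, v⟫ = 0) (hw : ‖v‖ ^ 2 < 2 * ⟪c - p, w⟫) :
    ∀ᶠ s in 𝓝[>] (0 : ℝ), p + s • v + s ^ 2 • w ∈ ball c (dist c p) := by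
  have hcont : Continuous fun s : ℝ => ‖v‖ ^ 2 - 2 * ⟪c - p, w⟫ + 2 * s * ⟪v, w⟫ +
      s ^ 2 * ‖w‖ ^ 2 := by fun_prop
  have hneg := ((hcont.tendsto 0).mono_left (nhdsWithin_le_nhds (s := Ioi 0))).eventually
    (gt_mem_nhds (a := 0) (by simpa using hw))
  filter_upwards [hneg, self_mem_nhdsWithin] with s hs hs0
  have hs0 : 0 < s := hs0
  rw [mem_ball, dist_eq_norm, dist_eq_norm]
  refine lt_of_pow_lt_pow_left₀ 2 (norm_nonneg _) ?_
  have h1 : p + s • v + s ^ 2 • w - c = (s • v + s ^ 2 • w) - (c - p) := by abel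
  have h2 : ‖s • v + s ^ 2 • w‖ ^ 2 =
      s ^ 2 * ‖v‖ ^ 2 + 2 * (s * (s ^ 2 * ⟪v, w⟫)) + (s ^ 2) ^ 2 * ‖w‖ ^ 2 := by
    rw [norm_add_sq_real, norm_smul, norm_smul, real_inner_smul_left, real_inner_smul_right,
      mul_pow, mul_pow, Real.norm_eq_abs, Real.norm_eq_abs, sq_abs, sq_abs]
  have h3 : ⟪s • v + s ^ 2 • w, c - p⟫ = s ^ 2 * ⟪c - p, w⟫ := by
    rw [real_inner_comm, inner_add_right, real_inner_smul_right, real_inner_smul_right, hv]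
    ring
  rw [h1, norm_sub_sq_real, h2, h3]
  nlinarith [mul_pos hs0 hs0]

variable {n : ℕ} {D : Set (EuclideanSpace ℝ (Fin n))} {p : EuclideanSpace ℝ (Fin n)}
  {U : Set (EuclideanSpace ℝ (Fin n))} {φ : EuclideanSpace ℝ (Fin n) → ℝ}

/-- The unit normal vector at `x` of the level set of `φ` through `x`, pointing in the direction in
which `φ` increases. -/
noncomputable def unitNormal (φ : EuclideanSpace ℝ (Fin n) → ℝ) (x : EuclideanSpace ℝ (Fin n)) :
    EuclideanSpace ℝ (Fin n) :=
  ‖fderiv ℝ φ x‖⁻¹ • sharp (fderiv ℝ φ x)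

namespace IsLocalDefiningFunction

theorem of_le {r s : WithTop ℕ∞} (h : IsLocalDefiningFunction r D p U φ) (hs : s ≤ r) :
    IsLocalDefiningFunction s D p U φ :=
  { h with contDiffOn := h.contDiffOn.of_le hs }

theorem norm_pos {r : WithTop ℕ∞} (h : IsLocalDefiningFunction r D p U φ)
    {x : EuclideanSpace ℝ (Fin n)} (hx : x ∈ U) : 0 < ‖fderiv ℝ φ x‖ :=
  norm_pos_iff.2 (h.fderiv_ne_zero x hx)

theorem contDiffAt {r : WithTop ℕ∞} (h : IsLocalDefiningFunction r D p U φ)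
    {x : EuclideanSpace ℝ (Fin n)} (hx : x ∈ U) : ContDiffAt ℝ r φ x :=
  h.contDiffOn.contDiffAt (h.isOpen.mem_nhds hx)

theorem norm_unitNormal {r : WithTop ℕ∞} (h : IsLocalDefiningFunction r D p U φ)
    {x : EuclideanSpace ℝ (Fin n)} (hx : x ∈ U) : ‖unitNormal φ x‖ = 1 := by
  have := h.norm_pos hx
  rw [unitNormal, norm_smul, norm_sharp, norm_inv, norm_norm, inv_mul_cancel₀ this.ne']

/-- With `eventually_pos`, this reads the gradient and the tangential Hessian of `φ` from membership
in `D` alone. All comparisons of two defining functions, or of `D` with a ball, come from it. -/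
theorem eventually_neg (h2 : IsLocalDefiningFunction 2 D p U φ)
    {v w : EuclideanSpace ℝ (Fin n)} (hv : fderiv ℝ φ p v = 0)
    (hneg : fderiv ℝ φ p w + hess φ p v v / 2 < 0) :
    ∀ᶠ s in 𝓝[>] (0 : ℝ), p + s • v + s ^ 2 • w ∈ D := by
  filter_upwards [eventually_neg_along_parabola (h2.contDiffAt h2.mem) h2.zero hv hneg,
    (tendsto_parabola p v w).eventually (h2.isOpen.mem_nhds h2.mem)] with s hs hsU
  exact (h2.neg_iff _ hsU).2 hs

theorem eventually_pos (h2 : IsLocalDefiningFunction 2 D p U φ)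
    {v w : EuclideanSpace ℝ (Fin n)} (hv : fderiv ℝ φ p v = 0)
    (hpos : 0 < fderiv ℝ φ p w + hess φ p v v / 2) :
    ∀ᶠ s in 𝓝[>] (0 : ℝ), p + s • v + s ^ 2 • w ∉ D := by
  filter_upwards [eventually_pos_along_parabola (h2.contDiffAt h2.mem) h2.zero hv hpos,
    (tendsto_parabola p v w).eventually (h2.isOpen.mem_nhds h2.mem)] with s hs hsU h
  exact lt_asymm hs ((h2.neg_iff _ hsU).1 h)

theorem mem_frontier (h2 : IsLocalDefiningFunction 2 D p U φ) : p ∈ frontier D := by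
  have hN := h2.norm_pos h2.mem
  rw [frontier_eq_closure_inter_closure]
  have h0 : hess φ p 0 0 = 0 := by simp [hess]
  constructor
  · refine mem_closure_of_tendsto (tendsto_parabola p 0 (-sharp (fderiv ℝ φ p)))
      (h2.eventually_neg (by simp) ?_)
    rw [h0, map_neg, apply_sharp_self]
    have := pow_pos hN 2
    linarith
  · refine mem_closure_of_tendsto (tendsto_parabola p 0 (sharp (fderiv ℝ φ p)))
      (h2.eventually_pos (by simp) ?_)
    rw [h0, apply_sharp_self]
    have := pow_pos hN 2
    linarith

/-- A local defining function vanishes on the boundary. -/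
theorem eq_zero_of_mem_frontier (h2 : IsLocalDefiningFunction 2 D p U φ) {q : EuclideanSpace ℝ (Fin n)}
    (hqU : q ∈ U) (hq : q ∈ frontier D) : φ q = 0 := by
  have hc : ContinuousAt φ q := (h2.contDiffAt hqU).continuousAt
  rw [frontier_eq_closure_inter_closure] at hq
  have hU := h2.isOpen.mem_nhds hqU
  refine le_antisymm ?_ ?_
  · by_contra hlt
    push Not at hlt
    obtain ⟨y, ⟨hy1, hy2⟩, hyD⟩ := mem_closure_iff_nhds.1 hq.1 _
      (Filter.inter_mem hU (hc.eventually (lt_mem_nhds hlt)))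
    exact lt_asymm hy2 ((h2.neg_iff y hy1).1 hyD)
  · by_contra hlt
    push Not at hlt
    obtain ⟨y, ⟨hy1, hy2⟩, hyD⟩ := mem_closure_iff_nhds.1 hq.2 _
      (Filter.inter_mem hU (hc.eventually (gt_mem_nhds hlt)))
    exact hyD ((h2.neg_iff y hy1).2 hy2)

/-- A defining function near a boundary point is a defining function near the boundary points close
to it. -/
theorem of_mem_frontier {r : WithTop ℕ∞} (h : IsLocalDefiningFunction r D p U φ) (hr : 2 ≤ r)
    {q : EuclideanSpace ℝ (Fin n)} (hqU : q ∈ U) (hq : q ∈ frontier D) :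
    IsLocalDefiningFunction r D q U φ :=
  { h with mem := hqU, zero := (h.of_le hr).eq_zero_of_mem_frontier hqU hq }

/-- The outer unit normal does not depend on the defining function. -/
theorem unitNormal_eq {V : Set (EuclideanSpace ℝ (Fin n))} {ψ : EuclideanSpace ℝ (Fin n) → ℝ}
    (hφ : IsLocalDefiningFunction 2 D p U φ) (hψ : IsLocalDefiningFunction 2 D p V ψ) :
    unitNormal φ p = unitNormal ψ p := by
  have key : ‖-sharp (fderiv ℝ φ p)‖ • sharp (fderiv ℝ ψ p) =
      -(‖fderiv ℝ ψ p‖ • -sharp (fderiv ℝ φ p)) := by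
    refine norm_smul_sharp_eq_of_nonpos fun w hw => ?_
    rw [inner_neg_left, inner_sharp] at hw
    by_contra hlt
    push Not at hlt
    obtain ⟨s, h1, h2⟩ := ((hφ.eventually_neg (v := 0) (w := w) (by simp)
      (by simp only [hess, map_zero]; linarith)).and
      (hψ.eventually_pos (v := 0) (w := w) (by simp)
        (by simp only [hess, map_zero]; linarith))).exists
    exact h2 h1
  rw [norm_neg, norm_sharp, smul_neg, neg_neg] at key
  have h1 := hφ.norm_pos hφ.mem
  have h2 := hψ.norm_pos hψ.mem
  rw [unitNormal, unitNormal, inv_smul_eq_iff₀ h1.ne', smul_comm, key, inv_smul_smul₀ h2.ne']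

theorem fderiv_apply_eq {r : WithTop ℕ∞} (h : IsLocalDefiningFunction r D p U φ)
    (v : EuclideanSpace ℝ (Fin n)) :
    fderiv ℝ φ p v = ‖fderiv ℝ φ p‖ * ⟪unitNormal φ p, v⟫ := by
  rw [unitNormal, real_inner_smul_left, inner_sharp, mul_inv_cancel_left₀ (h.norm_pos h.mem).ne']

/-- If the inequality failed, choose `k` strictly between the two values: the parabola with velocity
`v` and curvature `k` towards the inner normal would enter `D` according to `φ` and avoid `D`
according to `ψ`. -/
theorem secondFundamentalForm_self_le {V : Set (EuclideanSpace ℝ (Fin n))}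
    {ψ : EuclideanSpace ℝ (Fin n) → ℝ}
    (hφ : IsLocalDefiningFunction 2 D p U φ) (hψ : IsLocalDefiningFunction 2 D p V ψ)
    {v : EuclideanSpace ℝ (Fin n)} (hv : ⟪unitNormal φ p, v⟫ = 0) :
    secondFundamentalForm ψ p v v ≤ secondFundamentalForm φ p v v := by
  have hN := hφ.unitNormal_eq hψ
  have h1 := hφ.norm_pos hφ.mem
  have h2 := hψ.norm_pos hψ.mem
  have hw1 : ∀ k : ℝ, fderiv ℝ φ p (-(k • unitNormal φ p)) = -k * ‖fderiv ℝ φ p‖ := by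
    intro k
    rw [hφ.fderiv_apply_eq, inner_neg_right, real_inner_smul_right, real_inner_self_eq_norm_sq,
      hφ.norm_unitNormal hφ.mem]
    ring
  have hw2 : ∀ k : ℝ, fderiv ℝ ψ p (-(k • unitNormal φ p)) = -k * ‖fderiv ℝ ψ p‖ := by
    intro k
    rw [hψ.fderiv_apply_eq, hN, inner_neg_right, real_inner_smul_right,
      real_inner_self_eq_norm_sq, hψ.norm_unitNormal hψ.mem]
    ring
  by_contra hlt
  push Not at hlt
  obtain ⟨k, hk1, hk2⟩ := exists_between hlt
  rw [secondFundamentalForm, div_lt_iff₀ h1] at hk1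
  rw [secondFundamentalForm, lt_div_iff₀ h2] at hk2
  obtain ⟨s, h1, h2⟩ := ((hφ.eventually_neg (v := v) (w := -((k / 2) • unitNormal φ p))
      (by rw [hφ.fderiv_apply_eq, hv, mul_zero]) (by rw [hw1]; linarith)).and
      (hψ.eventually_pos (v := v) (w := -((k / 2) • unitNormal φ p))
        (by rw [hψ.fderiv_apply_eq, ← hN, hv, mul_zero]) (by rw [hw2]; linarith))).exists
  exact h2 h1

theorem _root_.MConvex.hess_comm (hφ : ContDiffAt ℝ 2 φ p) (v w : EuclideanSpace ℝ (Fin n)) :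
    hess φ p v w = hess φ p w v :=
  (hφ.isSymmSndFDerivAt (by simp)) v w

theorem _root_.MConvex.hess_add_self (hφ : ContDiffAt ℝ 2 φ p) (v w : EuclideanSpace ℝ (Fin n)) :
    hess φ p (v + w) (v + w) = hess φ p v v + 2 * hess φ p v w + hess φ p w w := by
  have := hess_comm hφ v w
  simp only [hess, map_add, add_apply] at this ⊢
  linarith

/-- The second fundamental form does not depend on the defining function. -/
theorem secondFundamentalForm_eq {V : Set (EuclideanSpace ℝ (Fin n))}
    {ψ : EuclideanSpace ℝ (Fin n) → ℝ}
    (hφ : IsLocalDefiningFunction 2 D p U φ) (hψ : IsLocalDefiningFunction 2 D p V ψ)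
    {v w : EuclideanSpace ℝ (Fin n)} (hv : ⟪unitNormal φ p, v⟫ = 0)
    (hw : ⟪unitNormal φ p, w⟫ = 0) :
    secondFundamentalForm φ p v w = secondFundamentalForm ψ p v w := by
  have key : ∀ z, ⟪unitNormal φ p, z⟫ = 0 →
      secondFundamentalForm φ p z z = secondFundamentalForm ψ p z z := fun z hz =>
    le_antisymm (hψ.secondFundamentalForm_self_le hφ (by rwa [← hφ.unitNormal_eq hψ]))
      (hφ.secondFundamentalForm_self_le hψ hz)
  have h1 := key v hv
  have h2 := key w hw
  have h3 := key (v + w) (by rw [inner_add_right, hv, hw, add_zero])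
  simp only [secondFundamentalForm, hess_add_self (hφ.contDiffAt hφ.mem),
    hess_add_self (hψ.contDiffAt hψ.mem), add_div] at h1 h2 h3 ⊢
  have h4 : 2 * hess φ p v w / ‖fderiv ℝ φ p‖ = 2 * hess ψ p v w / ‖fderiv ℝ ψ p‖ := by linarith
  rw [mul_div_assoc, mul_div_assoc] at h4
  linarith

/-- A ball inside `D` which touches `frontier D` at `p` is centred on the inner normal at `p`. -/
theorem sub_eq_of_ball_subset (hφ : IsLocalDefiningFunction 2 D p U φ)
    {c : EuclideanSpace ℝ (Fin n)} (hball : ball c (dist c p) ⊆ D) :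
    c - p = -(dist c p • unitNormal φ p) := by
  have key : ‖c - p‖ • sharp (fderiv ℝ φ p) = -(‖fderiv ℝ φ p‖ • (c - p)) := by
    refine norm_smul_sharp_eq_of_nonpos fun w hw => ?_
    by_contra hlt
    push Not at hlt
    obtain ⟨s, h1, h2⟩ := ((hφ.eventually_pos (v := 0) (w := w) (by simp)
      (by simp only [hess, map_zero]; linarith)).and
      (eventually_parabola_mem_ball (v := 0) (w := w) (c := c) (p := p) (by simp)
        (by simpa using hw))).exists
    exact h1 (hball h2)
  have h0 := hφ.norm_pos hφ.mem
  rw [unitNormal, smul_comm, dist_eq_norm, key, smul_neg, neg_neg, inv_smul_smul₀ h0.ne']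

/-- A ball outside `D` which touches `frontier D` at `p` is centred on the outer normal at `p`. -/
theorem sub_eq_of_ball_subset_compl (hφ : IsLocalDefiningFunction 2 D p U φ)
    {c : EuclideanSpace ℝ (Fin n)} (hball : ball c (dist c p) ⊆ Dᶜ) :
    c - p = dist c p • unitNormal φ p := by
  have key : ‖c - p‖ • sharp (-fderiv ℝ φ p) = -(‖-fderiv ℝ φ p‖ • (c - p)) := by
    refine norm_smul_sharp_eq_of_nonpos fun w hw => ?_
    rw [neg_apply]
    by_contra hlt
    push Not at hlt
    obtain ⟨s, h1, h2⟩ := ((hφ.eventually_neg (v := 0) (w := w) (by simp)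
      (by simp only [hess, map_zero]; linarith)).and
      (eventually_parabola_mem_ball (v := 0) (w := w) (c := c) (p := p) (by simp)
        (by simpa using hw))).exists
    exact hball h2 h1
  have h0 := hφ.norm_pos hφ.mem
  rw [map_neg, smul_neg, neg_inj, norm_neg] at key
  rw [unitNormal, smul_comm, dist_eq_norm, key, inv_smul_smul₀ h0.ne']

/-- A ball inside `D` which touches `frontier D` at `p` bounds the second fundamental form from
above. -/
theorem hess_le_of_ball_subset (hφ : IsLocalDefiningFunction 2 D p U φ)
    {R : ℝ} (hR : 0 < R) (hball : ball (p - R • unitNormal φ p) R ⊆ D)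
    {v : EuclideanSpace ℝ (Fin n)} (hv : fderiv ℝ φ p v = 0) :
    hess φ p v v ≤ ‖v‖ ^ 2 * ‖fderiv ℝ φ p‖ / R := by
  have hN := hφ.norm_unitNormal hφ.mem
  have h0 := hφ.norm_pos hφ.mem
  have hNv : ⟪unitNormal φ p, v⟫ = 0 := by
    have := hφ.fderiv_apply_eq v
    rw [hv] at this
    exact (mul_eq_zero.1 this.symm).resolve_left h0.ne'
  set c := p - R • unitNormal φ p with hc
  have hcp : c - p = -(R • unitNormal φ p) := by rw [hc]; abel
  have hcd : dist c p = R := by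
    rw [dist_eq_norm, hcp, norm_neg, norm_smul, hN, mul_one, Real.norm_of_nonneg hR.le]
  by_contra hlt
  push Not at hlt
  rw [div_lt_iff₀ hR, ← lt_div_iff₀ h0] at hlt
  -- The parabola with coefficient `k / (2 * R)` bends more than the sphere and less than `frontier
  -- D`, so it would lie in the ball and outside `D`.
  obtain ⟨k, hk1, hk2⟩ := exists_between hlt
  have hw : fderiv ℝ φ p (-((k / (2 * R)) • unitNormal φ p)) =
      -(k / (2 * R)) * ‖fderiv ℝ φ p‖ := by
    rw [hφ.fderiv_apply_eq, inner_neg_right, real_inner_smul_right, real_inner_self_eq_norm_sq, hN]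
    ring
  obtain ⟨s, h1, h2⟩ := ((hφ.eventually_pos (v := v) (w := -((k / (2 * R)) • unitNormal φ p)) hv
    (by
      rw [hw]
      rw [lt_div_iff₀ h0] at hk2
      have : k / (2 * R) * ‖fderiv ℝ φ p‖ < hess φ p v v / 2 := by
        rw [div_mul_eq_mul_div, div_lt_iff₀ (by positivity)]
        linarith
      linarith)).and
    (eventually_parabola_mem_ball (v := v) (w := -((k / (2 * R)) • unitNormal φ p)) (c := c)
      (p := p)
      (by rw [hcp, inner_neg_left, real_inner_smul_left, hNv]; simp)
      (by
        rw [hcp, inner_neg_neg, real_inner_smul_left, real_inner_smul_right,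
          real_inner_self_eq_norm_sq, hN]
        have : 2 * (R * (k / (2 * R) * 1 ^ 2)) = k := by field_simp
        rwa [this]))).exists
  rw [hcd] at h2
  exact h1 (hball h2)

end IsLocalDefiningFunction

end DefiningFunctions

/-! ### Regularity of the foot-point map -/

section InverseFunction

open scoped RealInnerProductSpace

/-- If each `x` near `x₀` is written as `π x + l x • ∇φ (π x)` with `φ (π x) = 0`, where `φ` has
class `C^(k+1)`, and if no focal point interferes, then `π` has class `C^k` near `x₀`. -/
theorem eventually_contDiffAt_foot {n : ℕ} {k : WithTop ℕ∞} (hk : 1 ≤ k)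
    {φ : EuclideanSpace ℝ (Fin n) → ℝ} {U : Set (EuclideanSpace ℝ (Fin n))} (hU : IsOpen U)
    (hφ : ContDiffOn ℝ (k + 1) φ U) {x₀ : EuclideanSpace ℝ (Fin n)}
    {π : EuclideanSpace ℝ (Fin n) → EuclideanSpace ℝ (Fin n)}
    {l : EuclideanSpace ℝ (Fin n) → ℝ}
    (hmem : π x₀ ∈ U) (hg : fderiv ℝ φ (π x₀) ≠ 0)
    (hinj : ∀ v, fderiv ℝ φ (π x₀) v = 0 → v ≠ 0 → 0 < ‖v‖ ^ 2 + l x₀ * hess φ (π x₀) v v)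
    (hπ : ContinuousAt π x₀) (hl : ContinuousAt l x₀)
    (heq : ∀ᶠ x in 𝓝 x₀, x = π x + l x • sharp (fderiv ℝ φ (π x)) ∧ φ (π x) = 0) :
    ∀ᶠ x in 𝓝 x₀, ContDiffAt ℝ k π x := by
  have hk0 : k ≠ 0 := fun h => by simp [h] at hk
  -- `π` is the first component of the local inverse of `Ψ` along `(x, 0)`; continuity of `π` and
  -- `l` ensures that this inverse selects the given foot point.
  set Ψ : EuclideanSpace ℝ (Fin n) × ℝ → EuclideanSpace ℝ (Fin n) × ℝ :=
    fun z => (z.1 + z.2 • sharp (fderiv ℝ φ z.1), φ z.1) with hΨ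
  have hG : ContDiffOn ℝ k (fderiv ℝ φ) U := hφ.fderiv_of_isOpen hU le_rfl
  have hΨc : ContDiffOn ℝ k Ψ (U ×ˢ univ) := by
    have hfst : ContDiffOn ℝ k (Prod.fst : EuclideanSpace ℝ (Fin n) × ℝ → _) (U ×ˢ univ) :=
      contDiff_fst.contDiffOn
    have hsnd : ContDiffOn ℝ k (Prod.snd : EuclideanSpace ℝ (Fin n) × ℝ → _) (U ×ˢ univ) :=
      contDiff_snd.contDiffOn
    have hmaps : MapsTo (Prod.fst : EuclideanSpace ℝ (Fin n) × ℝ → _) (U ×ˢ univ) U :=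
      fun z hz => hz.1
    exact (hfst.add (hsnd.smul (sharp.contDiff.comp_contDiffOn (hG.comp hfst hmaps)))).prodMk
      ((hφ.of_le le_self_add).comp hfst hmaps)
  have hopen : IsOpen (U ×ˢ (univ : Set ℝ)) := hU.prod isOpen_univ
  set z₀ : EuclideanSpace ℝ (Fin n) × ℝ := (π x₀, l x₀) with hz₀
  have hz₀U : U ×ˢ univ ∈ 𝓝 z₀ := hopen.mem_nhds ⟨hmem, mem_univ _⟩
  have hΨ₀ : ContDiffAt ℝ k Ψ z₀ := hΨc.contDiffAt hz₀U
  have hder : ∀ v a, fderiv ℝ Ψ z₀ (v, a) =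
      (v + (l x₀ • sharp (fderiv ℝ (fderiv ℝ φ) (π x₀) v) + a • sharp (fderiv ℝ φ (π x₀))),
        fderiv ℝ φ (π x₀) v) := by
    intro v a
    have h1 : HasFDerivAt (Prod.fst : EuclideanSpace ℝ (Fin n) × ℝ → _)
      (ContinuousLinearMap.fst ℝ _ _) z₀ := hasFDerivAt_fst
    have h2 : HasFDerivAt (Prod.snd : EuclideanSpace ℝ (Fin n) × ℝ → _)
      (ContinuousLinearMap.snd ℝ _ _) z₀ := hasFDerivAt_snd
    have h3 : HasFDerivAt (fderiv ℝ φ) (fderiv ℝ (fderiv ℝ φ) (π x₀)) z₀.1 :=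
      ((hG.contDiffAt (hU.mem_nhds hmem)).differentiableAt hk0).hasFDerivAt
    have h4 : HasFDerivAt φ (fderiv ℝ φ (π x₀)) z₀.1 :=
      ((hφ.contDiffAt (hU.mem_nhds hmem)).differentiableAt (by simp)).hasFDerivAt
    have h5 := sharp.hasFDerivAt.comp z₀ (h3.comp z₀ h1)
    have h6 := (h1.add (h2.smul h5)).prodMk (h4.comp z₀ h1)
    have h7 : HasFDerivAt Ψ _ z₀ := h6
    rw [h7.fderiv]
    simp [hz₀]
  have hinj' : Function.Injective (fderiv ℝ Ψ z₀).toLinearMap := by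
    rw [injective_iff_map_eq_zero]
    rintro ⟨v, a⟩ hva
    rw [ContinuousLinearMap.coe_coe, hder, Prod.mk_eq_zero] at hva
    obtain ⟨h1, h2⟩ := hva
    -- A kernel vector has `v` tangent, and pairing with `v` removes the normal term: what remains
    -- is the expression that `hinj` declares positive.
    have h3 := congrArg (fun z => ⟪z, v⟫) h1
    simp only [inner_add_left, real_inner_smul_left, inner_sharp, real_inner_self_eq_norm_sq,
      inner_zero_left, h2, mul_zero, add_zero] at h3
    have hv : v = 0 := by
      by_contra hv
      exact (hinj v h2 hv).ne' h3
    subst hv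
    simp only [map_zero, smul_zero, zero_add] at h1
    have : sharp (fderiv ℝ φ (π x₀)) ≠ 0 := by
      rw [← norm_ne_zero_iff, norm_sharp, norm_ne_zero_iff]; exact hg
    rw [(smul_eq_zero.1 h1).resolve_right this]
    rfl
  obtain ⟨e, he⟩ : ∃ e : (EuclideanSpace ℝ (Fin n) × ℝ) ≃L[ℝ] (EuclideanSpace ℝ (Fin n) × ℝ),
      (e : _ →L[ℝ] _) = fderiv ℝ Ψ z₀ :=
    ⟨(LinearEquiv.ofInjectiveEndo _ hinj').toContinuousLinearEquiv, ContinuousLinearMap.ext fun _ => rfl⟩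
  have hder₀ : HasFDerivAt Ψ (e : _ →L[ℝ] _) z₀ := by
    rw [he]; exact (hΨ₀.differentiableAt hk0).hasFDerivAt
  set f := hΨ₀.toOpenPartialHomeomorph Ψ hder₀ hk0 with hf
  have hfc : ∀ z, f z = Ψ z := fun z => by
    rw [hf, ContDiffAt.toOpenPartialHomeomorph_coe]
  have hsrc : f.source ∈ 𝓝 z₀ :=
    f.open_source.mem_nhds (hΨ₀.mem_toOpenPartialHomeomorph_source hder₀ hk0)
  -- For `k = ∞`, being `C^k` at one point does not spread to a neighbourhood. So invertibility of
  -- the derivative is spread instead, and smoothness of the inverse is obtained at each nearby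
  -- point.
  have hinv : ∀ᶠ z in 𝓝 z₀, fderiv ℝ Ψ z ∈
      range ((↑) : ((EuclideanSpace ℝ (Fin n) × ℝ) ≃L[ℝ] (EuclideanSpace ℝ (Fin n) × ℝ)) → _) := by
    have hc : ContinuousAt (fderiv ℝ Ψ) z₀ :=
      (hΨ₀.fderiv_right (m := 0) (by simpa using hk)).continuousAt
    refine hc.eventually ?_
    rw [← he]
    exact e.nhds
  have hlim : Filter.Tendsto (fun x => (π x, l x)) (𝓝 x₀) (𝓝 z₀) := hπ.prodMk hl
  have hgood : ∀ᶠ x in 𝓝 x₀, ContDiffAt ℝ k (fun y => (f.symm (y, 0)).1) x ∧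
      (f.symm (x, 0)).1 = π x := by
    filter_upwards [hlim.eventually hsrc, hlim.eventually hinv, hlim.eventually hz₀U, heq]
      with x hxs hxi hxU hxe
    have hΨx : f (π x, l x) = (x, 0) := by
      rw [hfc, hΨ]
      exact Prod.ext hxe.1.symm hxe.2
    have hsymm : f.symm (x, 0) = (π x, l x) := by rw [← hΨx, f.left_inv hxs]
    refine ⟨?_, by rw [hsymm]⟩
    have hΨk : ContDiffAt ℝ k Ψ (π x, l x) := hΨc.contDiffAt (hopen.mem_nhds hxU)
    obtain ⟨e', he'⟩ := hxi
    have htar : (x, (0 : ℝ)) ∈ f.target := by rw [← hΨx]; exact f.map_source hxs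
    have hsm : ContDiffAt ℝ k f.symm (x, 0) := by
      refine f.contDiffAt_symm (f₀' := e') htar ?_ ?_
      · rw [hsymm, he']
        exact (hΨk.differentiableAt hk0).hasFDerivAt
      · rw [hsymm]
        exact hΨk
    exact contDiff_fst.contDiffAt.comp x (hsm.comp x (contDiffAt_id.prodMk contDiffAt_const))
  filter_upwards [hgood.eventually_nhds] with x hx
  exact hx.self_of_nhds.1.congr_of_eventuallyEq (hx.mono fun y hy => hy.2.symm)

end InverseFunction

/-! ### The signed distance and inner touching balls -/

section Domain

open scoped RealInnerProductSpace

variable {n : ℕ} {Ω : Set (EuclideanSpace ℝ (Fin n))}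

theorem signedDistance_of_mem {x : EuclideanSpace ℝ (Fin n)} (hx : x ∈ Ω) :
    signedDistance Ω x = -infDist x (frontier Ω) := if_pos hx

theorem signedDistance_of_notMem {x : EuclideanSpace ℝ (Fin n)} (hx : x ∉ Ω) :
    signedDistance Ω x = infDist x (frontier Ω) := if_neg hx

theorem abs_signedDistance (x : EuclideanSpace ℝ (Fin n)) :
    |signedDistance Ω x| = infDist x (frontier Ω) := by
  by_cases hx : x ∈ Ω
  · rw [signedDistance_of_mem hx, abs_neg, abs_of_nonneg infDist_nonneg]
  · rw [signedDistance_of_notMem hx, abs_of_nonneg infDist_nonneg]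

theorem mem_of_signedDistance_neg {x : EuclideanSpace ℝ (Fin n)} (hx : signedDistance Ω x < 0) :
    x ∈ Ω := by
  by_contra h
  rw [signedDistance_of_notMem h] at hx
  exact hx.not_ge infDist_nonneg

theorem signedDistance_of_mem_frontier {x : EuclideanSpace ℝ (Fin n)} (hx : x ∈ frontier Ω) :
    signedDistance Ω x = 0 := by
  rw [← abs_eq_zero, abs_signedDistance, infDist_zero_of_mem hx]

theorem infDist_frontier_pos (hΩ : IsOpen Ω) (hne : (frontier Ω).Nonempty)
    {x : EuclideanSpace ℝ (Fin n)} (hx : x ∈ Ω) : 0 < infDist x (frontier Ω) := by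
  rw [← isClosed_frontier.notMem_iff_infDist_pos hne]
  exact fun h => (hΩ.frontier_eq ▸ h).2 hx

theorem signedDistance_neg_iff (hΩ : IsOpen Ω) (hne : (frontier Ω).Nonempty)
    {x : EuclideanSpace ℝ (Fin n)} : signedDistance Ω x < 0 ↔ x ∈ Ω :=
  ⟨mem_of_signedDistance_neg, fun hx => by
    rw [signedDistance_of_mem hx]
    exact neg_neg_of_pos (infDist_frontier_pos hΩ hne hx)⟩

theorem continuous_signedDistance : Continuous (signedDistance Ω) := by
  classical
  unfold signedDistance
  refine Continuous.if ?_ (continuous_infDist_pt _).neg (continuous_infDist_pt _)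
  intro a ha
  have ha : a ∈ frontier Ω := ha
  rw [infDist_zero_of_mem ha, neg_zero]

/-- A connected set which meets the open set `Ω` but not its boundary lies in `Ω`. -/
theorem subset_of_isPreconnected (hΩ : IsOpen Ω) {S : Set (EuclideanSpace ℝ (Fin n))}
    (hS : IsPreconnected S) (hdisj : ∀ x ∈ S, x ∉ frontier Ω) (hmeet : (S ∩ Ω).Nonempty) :
    S ⊆ Ω := by
  refine hS.subset_left_of_subset_union hΩ (isClosed_closure (s := Ω)).isOpen_compl
    (disjoint_compl_right.mono_left subset_closure |>.mono_right le_rfl) ?_ hmeet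
  intro x hx
  by_cases h : x ∈ Ω
  · exact Or.inl h
  · exact Or.inr fun hc => hdisj x hx (by rw [hΩ.frontier_eq]; exact ⟨hc, h⟩)

theorem notMem_frontier_of_mem_ball {c x : EuclideanSpace ℝ (Fin n)} {R : ℝ}
    (hR : R ≤ infDist c (frontier Ω)) (hx : x ∈ ball c R) : x ∉ frontier Ω := fun h => by
  have := infDist_le_dist_of_mem (x := c) h
  rw [mem_ball, dist_comm] at hx
  linarith

theorem ball_subset_of_le_infDist (hΩ : IsOpen Ω) {c : EuclideanSpace ℝ (Fin n)} {R : ℝ}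
    (hR : R ≤ infDist c (frontier Ω)) (hmeet : (ball c R ∩ Ω).Nonempty) : ball c R ⊆ Ω :=
  subset_of_isPreconnected hΩ (convex_ball c R).isPreconnected
    (fun _ hx => notMem_frontier_of_mem_ball hR hx) hmeet

variable {ε : ℝ}

theorem HasUniqueNearestPoints.existsUnique (hreach : HasUniqueNearestPoints ε (frontier Ω))
    (hne : (frontier Ω).Nonempty) (x : EuclideanSpace ℝ (Fin n))
    (hx : infDist x (frontier Ω) < ε) :
    ∃! p, p ∈ frontier Ω ∧ dist x p = infDist x (frontier Ω) :=
  hreach x ((mem_thickening_iff_infDist_lt hne).2 hx)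

/-- A point is reached from its nearest boundary point along the normal. -/
theorem sub_eq_signedDistance_smul (hΩ : IsOpen Ω) {x p : EuclideanSpace ℝ (Fin n)}
    (hd : dist x p = infDist x (frontier Ω))
    {U : Set (EuclideanSpace ℝ (Fin n))} {φ : EuclideanSpace ℝ (Fin n) → ℝ}
    (hφ : IsLocalDefiningFunction 2 Ω p U φ) :
    x - p = signedDistance Ω x • unitNormal φ p := by
  have hp := hφ.mem_frontier
  by_cases hx : x ∈ Ω
  · have hpos : 0 < dist x p := by
      rw [hd]; exact infDist_frontier_pos hΩ ⟨p, hp⟩ hx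
    rw [signedDistance_of_mem hx, ← hd, neg_smul]
    exact hφ.sub_eq_of_ball_subset
      (ball_subset_of_le_infDist hΩ hd.le ⟨x, mem_ball_self hpos, hx⟩)
  · rw [signedDistance_of_notMem hx, ← hd]
    -- If the ball met `Ω` it would lie in `Ω`, being connected and disjoint from the boundary; but
    -- its centre `x` is not in `Ω`.
    refine hφ.sub_eq_of_ball_subset_compl fun y hy hyΩ => hx ?_
    have hpos : 0 < dist x p := pos_of_mem_ball hy
    exact ball_subset_of_le_infDist hΩ hd.le ⟨y, hy, hyΩ⟩ (mem_ball_self hpos)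

theorem continuousAt_unitNormal {U : Set (EuclideanSpace ℝ (Fin n))}
    {φ : EuclideanSpace ℝ (Fin n) → ℝ} {p q : EuclideanSpace ℝ (Fin n)}
    (hφ : IsLocalDefiningFunction 2 Ω p U φ) (hq : q ∈ U) : ContinuousAt (unitNormal φ) q := by
  have h1 : ContinuousAt (fderiv ℝ φ) q :=
    ((hφ.contDiffAt hq).fderiv_right (m := 1) (by norm_num)).continuousAt
  exact (h1.norm.inv₀ (hφ.norm_pos hq).ne').smul (sharp.continuous.continuousAt.comp h1)

/-- The inner normal segment of length `s < ε` at a boundary point realizes the distance to the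
boundary. -/
theorem infDist_sub_smul_unitNormal (hΩ : IsOpen Ω)
    (hreach : HasUniqueNearestPoints ε (frontier Ω))
    {p : EuclideanSpace ℝ (Fin n)} {U : Set (EuclideanSpace ℝ (Fin n))}
    {φ : EuclideanSpace ℝ (Fin n) → ℝ} (hφ : IsLocalDefiningFunction 2 Ω p U φ)
    {s : ℝ} (hs : 0 ≤ s) (hsε : s < ε) :
    infDist (p - s • unitNormal φ p) (frontier Ω) = s := by
  have hp := hφ.mem_frontier
  have hne : (frontier Ω).Nonempty := ⟨p, hp⟩
  have huniq := hreach.existsUnique hne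
  by_contra hcon
  have hcont : ContinuousAt (fun q => infDist (q - s • unitNormal φ q) (frontier Ω)) p :=
    (continuous_infDist_pt _).continuousAt.comp
      (continuousAt_id.sub ((continuousAt_unitNormal hφ hφ.mem).const_smul s))
  have hnhds : U ∩ {q | infDist (q - s • unitNormal φ q) (frontier Ω) ≠ s} ∈ 𝓝 p :=
    Filter.inter_mem (hφ.isOpen.mem_nhds hφ.mem) (hcont.eventually (isOpen_ne.mem_nhds hcon))
  have hp0 : infDist p (frontier Ω) = 0 := infDist_zero_of_mem hp
  have hev := eventually_nearest_mem isClosed_frontier hp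
    (fun q hq hd => by rw [hp0, dist_eq_zero] at hd; exact hd.symm) hnhds
  have hevε : ∀ᶠ x in 𝓝 p, infDist x (frontier Ω) < ε :=
    (continuous_infDist_pt (frontier Ω)).continuousAt.eventually
      (gt_mem_nhds (hp0.trans_lt (hs.trans_lt hsε)))
  -- Points of `Ω` near `p` may have other nearest points. The identity is proved at such a nearest
  -- point `q`, which lies in the neighbourhood of `p` where it was assumed to fail.
  obtain ⟨x, hxΩ, hx1, hx2⟩ := ((mem_closure_iff_frequently.1 hp.1).and_eventually
    (hev.and hevε)).exists
  obtain ⟨q, hq, hqd⟩ := isClosed_frontier.exists_infDist_eq_dist hne x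
  obtain ⟨hqU, hqs⟩ := hx1 q hq hqd.symm
  have hφq := hφ.of_mem_frontier le_rfl hqU hq
  have hsub := sub_eq_signedDistance_smul hΩ hqd.symm hφq
  rw [signedDistance_of_mem hxΩ] at hsub
  refine hqs ?_
  have := infDist_add_smul_of_nearest isClosed_frontier huniq (x := x) (p := q)
    (u := -unitNormal φ q) hq (by rw [norm_neg, hφ.norm_unitNormal hqU])
    (by rw [smul_neg, ← neg_smul, ← hsub, add_sub_cancel])
    (infDist_frontier_pos hΩ hne hxΩ) hs hsε
  rwa [smul_neg, ← sub_eq_add_neg] at this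

/-- This turns uniqueness of nearest points into an upper curvature bound. The ball misses the
boundary, and it meets `Ω` because the inner normal at `p` starts out in both. -/
theorem ball_sub_smul_unitNormal_subset (hΩ : IsOpen Ω)
    (hreach : HasUniqueNearestPoints ε (frontier Ω))
    {p : EuclideanSpace ℝ (Fin n)} {U : Set (EuclideanSpace ℝ (Fin n))}
    {φ : EuclideanSpace ℝ (Fin n) → ℝ} (hφ : IsLocalDefiningFunction 2 Ω p U φ)
    {s : ℝ} (hs : 0 < s) (hsε : s < ε) :
    ball (p - s • unitNormal φ p) s ⊆ Ω := by
  refine ball_subset_of_le_infDist hΩ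
    (infDist_sub_smul_unitNormal hΩ hreach hφ hs.le hsε).ge ?_
  have hN := hφ.norm_unitNormal hφ.mem
  have hcp : p - s • unitNormal φ p - p = -(s • unitNormal φ p) := by abel
  have hd : dist (p - s • unitNormal φ p) p = s := by
    rw [dist_eq_norm, hcp, norm_neg, norm_smul, hN, mul_one, Real.norm_of_nonneg hs.le]
  obtain ⟨t, h1, h2⟩ := ((hφ.eventually_neg (v := 0) (w := -unitNormal φ p) (by simp)
      (by
        rw [hφ.fderiv_apply_eq, inner_neg_right, real_inner_self_eq_norm_sq, hN]
        have := hφ.norm_pos hφ.mem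
        simp only [hess, map_zero]
        linarith)).and
      (eventually_parabola_mem_ball (v := 0) (w := -unitNormal φ p)
        (c := p - s • unitNormal φ p) (p := p) (by simp)
        (by
          rw [hcp, inner_neg_neg, real_inner_smul_left, real_inner_self_eq_norm_sq, hN]
          simpa using hs))).exists
  rw [hd] at h2
  exact ⟨_, h2, h1⟩

theorem signedDistance_sub_smul_unitNormal (hΩ : IsOpen Ω)
    (hreach : HasUniqueNearestPoints ε (frontier Ω))
    {p : EuclideanSpace ℝ (Fin n)} {U : Set (EuclideanSpace ℝ (Fin n))}
    {φ : EuclideanSpace ℝ (Fin n) → ℝ} (hφ : IsLocalDefiningFunction 2 Ω p U φ)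
    {s : ℝ} (hs : 0 < s) (hsε : s < ε) :
    signedDistance Ω (p - s • unitNormal φ p) = -s := by
  rw [signedDistance_of_mem
    (ball_sub_smul_unitNormal_subset hΩ hreach hφ hs hsε (mem_ball_self hs)),
    infDist_sub_smul_unitNormal hΩ hreach hφ hs.le hsε]

end Domain

/-! ### The signed distance is as smooth as the boundary -/

section Regularity

open scoped RealInnerProductSpace

variable {n : ℕ} {Ω : Set (EuclideanSpace ℝ (Fin n))} {ε : ℝ}

/-- There are no focal points of the boundary at distance less than `ε` in the inner direction. -/
theorem focal_pos (hΩ : IsOpen Ω) (hreach : HasUniqueNearestPoints ε (frontier Ω))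
    {p : EuclideanSpace ℝ (Fin n)} {U : Set (EuclideanSpace ℝ (Fin n))}
    {φ : EuclideanSpace ℝ (Fin n) → ℝ} (hφ : IsLocalDefiningFunction 2 Ω p U φ)
    {t : ℝ} (ht : t ≤ 0) (htε : -ε < t) {v : EuclideanSpace ℝ (Fin n)}
    (hv : fderiv ℝ φ p v = 0) (hv0 : v ≠ 0) :
    0 < ‖v‖ ^ 2 + t / ‖fderiv ℝ φ p‖ * hess φ p v v := by
  have h0 := hφ.norm_pos hφ.mem
  have hvp : 0 < ‖v‖ ^ 2 := by positivity
  -- The touching ball of radius `s` bounds the second fundamental form by `‖v‖² / s`, and `-t / s <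
  -- 1`.
  obtain ⟨s, hs1, hs2⟩ := exists_between (show -t < ε by linarith)
  have hs : 0 < s := by linarith
  have hle := hφ.hess_le_of_ball_subset hs
    (ball_sub_smul_unitNormal_subset hΩ hreach hφ hs hs2) hv
  have h1 : -t / ‖fderiv ℝ φ p‖ * hess φ p v v ≤
      -t / ‖fderiv ℝ φ p‖ * (‖v‖ ^ 2 * ‖fderiv ℝ φ p‖ / s) :=
    mul_le_mul_of_nonneg_left hle (div_nonneg (by linarith) h0.le)
  have h2 : -t / ‖fderiv ℝ φ p‖ * (‖v‖ ^ 2 * ‖fderiv ℝ φ p‖ / s) = ‖v‖ ^ 2 * (-t / s) := by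
    field_simp
  have h3 : -t / s < 1 := by rw [div_lt_one hs]; exact hs1
  rw [h2, neg_div, neg_mul] at h1
  nlinarith

/-- The signed distance function is as regular as the boundary, its gradient at `x` is the outer
unit normal at the nearest boundary point. -/
theorem exists_contDiffOn_signedDistance {k : ℕ∞} (hk : 1 ≤ k) (hΩ : IsOpen Ω)
    (hbdry : HasBoundaryOfClass ((k : WithTop ℕ∞) + 1) Ω)
    (hreach : HasUniqueNearestPoints ε (frontier Ω)) (hne : (frontier Ω).Nonempty)
    {x₀ : EuclideanSpace ℝ (Fin n)} (hx₀ : signedDistance Ω x₀ ≤ 0)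
    (hx₀ε : -ε < signedDistance Ω x₀) :
    ∃ V, IsOpen V ∧ x₀ ∈ V ∧ ContDiffOn ℝ ((k : WithTop ℕ∞) + 1) (signedDistance Ω) V ∧
      ∀ x ∈ V, ∃ p U φ, IsLocalDefiningFunction 2 Ω p U φ ∧
        sharp (fderiv ℝ (signedDistance Ω) x) = unitNormal φ p ∧
        x = p + signedDistance Ω x • unitNormal φ p := by
  have hk' : (1 : WithTop ℕ∞) ≤ k := by exact_mod_cast hk
  have hk2 : (2 : WithTop ℕ∞) ≤ (k : WithTop ℕ∞) + 1 := by
    rw [← one_add_one_eq_two]; gcongr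
  have huniq := hreach.existsUnique hne
  choose π hπM hπd using fun x => (isClosed_frontier (s := Ω)).exists_infDist_eq_dist hne x
  obtain ⟨U, φ, hφ⟩ := hbdry (π x₀) (hπM x₀)
  have hφ2 := hφ.of_le hk2
  have hdist₀ : infDist x₀ (frontier Ω) < ε := by
    rw [← abs_signedDistance, abs_lt]
    exact ⟨hx₀ε, by linarith⟩
  have hπc : ContinuousAt π x₀ := by
    obtain ⟨p, -, hpu⟩ := huniq x₀ hdist₀
    intro W hW
    have := eventually_nearest_mem isClosed_frontier (hπM x₀) (x₀ := x₀) (fun q hq hqd => by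
      rw [hpu q ⟨hq, hqd⟩, hpu (π x₀) ⟨hπM x₀, (hπd x₀).symm⟩]) hW
    exact this.mono fun x hx => hx _ (hπM x) (hπd x).symm
  have hU : ∀ᶠ x in 𝓝 x₀, π x ∈ U := hπc.eventually (hφ.isOpen.mem_nhds hφ.mem)
  have hfoot : ∀ x, π x ∈ U → x - π x = signedDistance Ω x • unitNormal φ (π x) := fun x hx =>
    sub_eq_signedDistance_smul hΩ (hπd x).symm (hφ2.of_mem_frontier le_rfl hx (hπM x))
  have hgc : ContinuousAt (fun x => ‖fderiv ℝ φ (π x)‖) x₀ := by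
    have h1 : ContinuousAt (fderiv ℝ φ) (π x₀) :=
      ((hφ2.contDiffAt hφ2.mem).fderiv_right (m := 1) (by norm_num)).continuousAt
    exact (ContinuousAt.comp (f := π) h1 hπc).norm
  have hπk : ∀ᶠ x in 𝓝 x₀, ContDiffAt ℝ k π x := by
    refine eventually_contDiffAt_foot hk' hφ.isOpen hφ.contDiffOn
      (l := fun x => signedDistance Ω x / ‖fderiv ℝ φ (π x)‖) hφ.mem
      (hφ.fderiv_ne_zero _ hφ.mem) (fun v hv hv0 => focal_pos hΩ hreach hφ2 hx₀ hx₀ε hv hv0)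
      hπc (continuous_signedDistance.continuousAt.div hgc (hφ.norm_pos hφ.mem).ne') ?_
    filter_upwards [hU] with x hx
    refine ⟨?_, hφ2.eq_zero_of_mem_frontier hx (hπM x)⟩
    have := hfoot x hx
    rw [unitNormal, smul_smul, ← div_eq_mul_inv] at this
    rw [← this, add_sub_cancel]
  obtain ⟨V, hV, hVo, hxV⟩ := _root_.eventually_nhds_iff.1 (hU.and hπk)
  have hνk : ∀ x ∈ V, ContDiffAt ℝ k (fun y => unitNormal φ (π y)) x := by
    intro x hx
    have h1 : ContDiffAt ℝ k (fderiv ℝ φ) (π x) :=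
      (hφ.contDiffAt (hV x hx).1).fderiv_right le_rfl
    have h2 : ContDiffAt ℝ k (fun y => fderiv ℝ φ (π y)) x := h1.comp x (hV x hx).2
    have h3 : ContDiffAt ℝ k (fun y => sharp (fderiv ℝ φ (π y))) x :=
      sharp.contDiff.contDiffAt.comp x h2
    have hne0 : sharp (fderiv ℝ φ (π x)) ≠ 0 := by
      rw [← norm_ne_zero_iff, norm_sharp]
      exact (hφ.norm_pos (hV x hx).1).ne'
    have h4 := ((h3.norm ℝ hne0).inv (norm_ne_zero_iff.2 hne0)).smul h3
    simp only [norm_sharp] at h4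
    exact h4
  have hδeq : ∀ x ∈ V, signedDistance Ω x = ⟪x - π x, unitNormal φ (π x)⟫ := by
    intro x hx
    rw [hfoot x (hV x hx).1, real_inner_smul_left, real_inner_self_eq_norm_sq,
      hφ.norm_unitNormal (hV x hx).1]
    ring
  -- In the derivative of `⟪x - π x, N (π x)⟫` two terms drop out: `x - π x` is parallel to `N`,
  -- which has unit length, and `dπ` takes values tangent to the boundary.
  have hgrad : ∀ x ∈ V, HasFDerivAt (signedDistance Ω)
      (innerSL ℝ (unitNormal φ (π x))) x := by
    intro x hx
    have hk0 : (k : WithTop ℕ∞) ≠ 0 := fun h => by simp [h] at hk'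
    have hπd : HasFDerivAt π (fderiv ℝ π x) x := ((hV x hx).2.differentiableAt hk0).hasFDerivAt
    have hνd := ((hνk x hx).differentiableAt hk0).hasFDerivAt
    set π' := fderiv ℝ π x
    set ν' := fderiv ℝ (fun y => unitNormal φ (π y)) x
    have hVn : V ∈ 𝓝 x := hVo.mem_nhds hx
    have hδ' : HasFDerivAt (signedDistance Ω) _ x :=
      (((hasFDerivAt_id x).sub hπd).inner ℝ hνd).congr_of_eventuallyEq
        (by filter_upwards [hVn] with y hy using hδeq y hy)
    have hφπ : ∀ w, fderiv ℝ φ (π x) (π' w) = 0 := by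
      have h1 : HasFDerivAt (fun y => φ (π y)) ((fderiv ℝ φ (π x)).comp π') x :=
        (((hφ2.contDiffAt (hV x hx).1).differentiableAt (by norm_num)).hasFDerivAt).comp x hπd
      have h2 : HasFDerivAt (fun y => φ (π y)) (0 : StrongDual ℝ _) x :=
        (hasFDerivAt_const (0 : ℝ) x).congr_of_eventuallyEq
          (by filter_upwards [hVn] with y hy using hφ2.eq_zero_of_mem_frontier (hV y hy).1 (hπM y))
      intro w
      have := congrArg (fun L => L w) (h1.unique h2)
      simpa using this
    have hν1 : ∀ w, ⟪unitNormal φ (π x), ν' w⟫ = 0 := by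
      have h1 := hνd.inner ℝ hνd
      have h2 : HasFDerivAt (fun y => ⟪unitNormal φ (π y), unitNormal φ (π y)⟫)
          (0 : StrongDual ℝ _) x :=
        (hasFDerivAt_const (1 : ℝ) x).congr_of_eventuallyEq (by
          filter_upwards [hVn] with y hy
          rw [real_inner_self_eq_norm_sq, hφ.norm_unitNormal (hV y hy).1, one_pow])
      intro w
      have := congrArg (fun L => L w) (h1.unique h2)
      simp only [ContinuousLinearMap.comp_apply, ContinuousLinearMap.prod_apply,
        fderivInnerCLM_apply, zero_apply] at this
      rw [real_inner_comm (unitNormal φ (π x)) (ν' w)] at this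
      linarith
    refine hδ'.congr_fderiv ?_
    ext w
    have h3 := (hφ2.of_mem_frontier le_rfl (hV x hx).1 (hπM x)).fderiv_apply_eq (π' w)
    rw [hφπ w] at h3
    have h4 := (mul_eq_zero.1 h3.symm).resolve_left (hφ.norm_pos (hV x hx).1).ne'
    simp only [ContinuousLinearMap.comp_apply, ContinuousLinearMap.prod_apply,
      fderivInnerCLM_apply, innerSL_apply_apply, sub_apply, ContinuousLinearMap.id_apply]
    change ⟪x - π x, ν' w⟫ + ⟪w - π' w, unitNormal φ (π x)⟫ = ⟪unitNormal φ (π x), w⟫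
    rw [hfoot x (hV x hx).1, real_inner_smul_left, hν1, inner_sub_left, real_inner_comm w,
      real_inner_comm (unitNormal φ (π x)) (π' w), h4]
    ring
  have hfd : ∀ x ∈ V, fderiv ℝ (signedDistance Ω) x = innerSL ℝ (unitNormal φ (π x)) :=
    fun x hx => (hgrad x hx).fderiv
  refine ⟨V, hVo, hxV, ?_, fun x hx => ⟨π x, U, φ, hφ2.of_mem_frontier le_rfl (hV x hx).1 (hπM x),
    ?_, ?_⟩⟩
  -- Here the lost derivative is regained: `π` is only `C^k`, but the gradient of `δ` is the `C^k`
  -- map `N ∘ π`.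
  · rw [contDiffOn_succ_iff_fderiv_of_isOpen hVo]
    refine ⟨fun x hx => (hgrad x hx).differentiableAt.differentiableWithinAt,
      fun h => by simp at h, ?_⟩
    refine ContDiffOn.congr ?_ hfd
    exact (innerSL ℝ).contDiff.comp_contDiffOn fun x hx => (hνk x hx).contDiffWithinAt
  · rw [hfd x hx]
    refine ext_inner_right ℝ fun w => ?_
    rw [inner_sharp, innerSL_apply_apply]
  · rw [← hfoot x (hV x hx).1, add_sub_cancel]

end Regularity

/-! ### Gradient and Hessian of the signed distance along normals -/

section Tube

open scoped RealInnerProductSpace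

variable {n : ℕ} {Ω : Set (EuclideanSpace ℝ (Fin n))} {ε : ℝ}

/-- The gradient of the signed distance function. -/
noncomputable def outerNormal (Ω : Set (EuclideanSpace ℝ (Fin n))) (x : EuclideanSpace ℝ (Fin n)) :
    EuclideanSpace ℝ (Fin n) :=
  sharp (fderiv ℝ (signedDistance Ω) x)

/-- The Hessian of the signed distance function as an endomorphism. -/
noncomputable def shapeOperator (Ω : Set (EuclideanSpace ℝ (Fin n)))
    (x : EuclideanSpace ℝ (Fin n)) : EuclideanSpace ℝ (Fin n) →L[ℝ] EuclideanSpace ℝ (Fin n) :=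
  sharp.comp (fderiv ℝ (fderiv ℝ (signedDistance Ω)) x)

theorem inner_outerNormal (x v : EuclideanSpace ℝ (Fin n)) :
    ⟪outerNormal Ω x, v⟫ = fderiv ℝ (signedDistance Ω) x v := inner_sharp _ _

theorem inner_shapeOperator (x v w : EuclideanSpace ℝ (Fin n)) :
    ⟪shapeOperator Ω x v, w⟫ = hess (signedDistance Ω) x v w := inner_sharp _ _

/-- The signed distance function has gradient of length one at `x`, and `x` lies on the normal line
of a boundary point with the same normal. -/
def HasFoot (Ω : Set (EuclideanSpace ℝ (Fin n))) (x : EuclideanSpace ℝ (Fin n)) : Prop :=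
  ∃ p U φ, IsLocalDefiningFunction 2 Ω p U φ ∧ outerNormal Ω x = unitNormal φ p ∧
    x = p + signedDistance Ω x • unitNormal φ p

/-- `T` is an open set containing the one-sided tube `-ε < δ ≤ 0` on which the signed distance
function `δ` has class `C^r` and gradient equal to the outer normal at the nearest boundary
point. -/
structure IsTube (r : WithTop ℕ∞) (ε : ℝ) (Ω T : Set (EuclideanSpace ℝ (Fin n))) : Prop where
  isOpen_domain : IsOpen Ω
  nonempty_frontier : (frontier Ω).Nonempty
  uniqueNearest : HasUniqueNearestPoints ε (frontier Ω)
  isOpen : IsOpen T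
  mem : ∀ x, signedDistance Ω x ≤ 0 → -ε < signedDistance Ω x → x ∈ T
  contDiffOn : ContDiffOn ℝ r (signedDistance Ω) T
  two_le : 2 ≤ r
  hasFoot : ∀ x ∈ T, HasFoot Ω x

/-- `T` is the union of all good open sets. For `ε > 0` it contains the boundary, hence points
beyond it, which allows `ρ` to be smooth on a neighbourhood of the closure. -/
theorem exists_isTube {k : ℕ∞} (hk : 1 ≤ k) (hΩ : IsOpen Ω)
    (hbdry : HasBoundaryOfClass ((k : WithTop ℕ∞) + 1) Ω)
    (hreach : HasUniqueNearestPoints ε (frontier Ω)) (hne : (frontier Ω).Nonempty) :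
    ∃ T, IsTube ((k : WithTop ℕ∞) + 1) ε Ω T := by
  have hk2 : (2 : WithTop ℕ∞) ≤ (k : WithTop ℕ∞) + 1 := by
    have hk' : (1 : WithTop ℕ∞) ≤ k := by exact_mod_cast hk
    rw [← one_add_one_eq_two]; gcongr
  refine ⟨⋃₀ {V | IsOpen V ∧ ContDiffOn ℝ ((k : WithTop ℕ∞) + 1) (signedDistance Ω) V ∧
    ∀ x ∈ V, HasFoot Ω x}, hΩ, hne, hreach, isOpen_sUnion fun V hV => hV.1, ?_, ?_, hk2, ?_⟩
  · intro x hx hxε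
    obtain ⟨V, hV, hxV, hVc, hVf⟩ := exists_contDiffOn_signedDistance hk hΩ hbdry hreach hne hx hxε
    exact ⟨V, ⟨hV, hVc, hVf⟩, hxV⟩
  · rintro x ⟨V, hV, hxV⟩
    exact (hV.2.1.contDiffAt (hV.1.mem_nhds hxV)).contDiffWithinAt
  · rintro x ⟨V, hV, hxV⟩
    exact hV.2.2 x hxV

variable {r : WithTop ℕ∞} {T : Set (EuclideanSpace ℝ (Fin n))} {x : EuclideanSpace ℝ (Fin n)}

namespace IsTube

theorem contDiffAt (h : IsTube r ε Ω T) (hx : x ∈ T) : ContDiffAt ℝ 2 (signedDistance Ω) x :=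
  (h.contDiffOn.contDiffAt (h.isOpen.mem_nhds hx)).of_le h.two_le

theorem norm_outerNormal (h : IsTube r ε Ω T) (hx : x ∈ T) : ‖outerNormal Ω x‖ = 1 := by
  obtain ⟨p, U, φ, hφ, hN, -⟩ := h.hasFoot x hx
  rw [hN, hφ.norm_unitNormal hφ.mem]

theorem norm_fderiv (h : IsTube r ε Ω T) (hx : x ∈ T) :
    ‖fderiv ℝ (signedDistance Ω) x‖ = 1 := by
  rw [← norm_sharp]; exact h.norm_outerNormal hx

theorem hasFDerivAt_outerNormal (h : IsTube r ε Ω T) (hx : x ∈ T) :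
    HasFDerivAt (outerNormal Ω) (shapeOperator Ω x) x :=
  sharp.hasFDerivAt.comp x
    (((h.contDiffAt hx).fderiv_right (m := 1) (by norm_num)).differentiableAt
      (by norm_num)).hasFDerivAt

theorem shapeOperator_symm (h : IsTube r ε Ω T) (hx : x ∈ T) (v w : EuclideanSpace ℝ (Fin n)) :
    ⟪shapeOperator Ω x v, w⟫ = ⟪v, shapeOperator Ω x w⟫ := by
  rw [real_inner_comm (shapeOperator Ω x w), inner_shapeOperator, inner_shapeOperator,
    hess_comm (h.contDiffAt hx)]

theorem inner_shapeOperator_outerNormal (h : IsTube r ε Ω T) (hx : x ∈ T)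
    (v : EuclideanSpace ℝ (Fin n)) : ⟪shapeOperator Ω x v, outerNormal Ω x⟫ = 0 := by
  have h1 := (h.hasFDerivAt_outerNormal hx).inner ℝ (h.hasFDerivAt_outerNormal hx)
  have h2 : HasFDerivAt (fun y => ⟪outerNormal Ω y, outerNormal Ω y⟫) (0 : StrongDual ℝ _) x :=
    (hasFDerivAt_const (1 : ℝ) x).congr_of_eventuallyEq (by
      filter_upwards [h.isOpen.mem_nhds hx] with y hy
      rw [real_inner_self_eq_norm_sq, h.norm_outerNormal hy, one_pow])
  have := congrArg (fun L => L v) (h1.unique h2)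
  simp only [ContinuousLinearMap.comp_apply, ContinuousLinearMap.prod_apply,
    fderivInnerCLM_apply, zero_apply] at this
  rw [real_inner_comm (shapeOperator Ω x v) (outerNormal Ω x)] at this
  linarith

theorem signedDistance_add_smul (h : IsTube r ε Ω T) (hx : x ∈ T) {s : ℝ}
    (hs : signedDistance Ω x + s < 0) (hsε : -ε < signedDistance Ω x + s) :
    signedDistance Ω (x + s • outerNormal Ω x) = signedDistance Ω x + s := by
  obtain ⟨p, U, φ, hφ, hN, hxp⟩ := h.hasFoot x hx
  have h1 : x + s • outerNormal Ω x = p - (-(signedDistance Ω x + s)) • unitNormal φ p := by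
    rw [hN, neg_smul, sub_neg_eq_add, add_smul, ← add_assoc, ← hxp]
  rw [h1, signedDistance_sub_smul_unitNormal h.isOpen_domain h.uniqueNearest hφ
    (by linarith) (by linarith), neg_neg]

/-- The gradient of the signed distance function is constant along normal segments. -/
theorem outerNormal_add_smul (h : IsTube r ε Ω T) (hx : x ∈ T) {s : ℝ}
    (hs : signedDistance Ω x + s < 0) (hsε : -ε < signedDistance Ω x + s) :
    outerNormal Ω (x + s • outerNormal Ω x) = outerNormal Ω x := by
  have hδ := h.signedDistance_add_smul hx hs hsε
  set y := x + s • outerNormal Ω x with hy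
  obtain ⟨p, U, φ, hφ, hN, hxp⟩ := h.hasFoot x hx
  have hyT : y ∈ T := h.mem y (by rw [hδ]; exact hs.le) (by rw [hδ]; exact hsε)
  obtain ⟨q, V, ψ, hψ, hN', hyq⟩ := h.hasFoot y hyT
  have hyp : y = p + signedDistance Ω y • unitNormal φ p := by
    rw [hδ, add_smul, ← add_assoc, ← hxp, ← hN]
  obtain ⟨z, -, hz⟩ := h.uniqueNearest.existsUnique h.nonempty_frontier y (by
    rw [← abs_signedDistance, hδ, abs_lt]; constructor <;> linarith)
  have hdist : ∀ {a N : EuclideanSpace ℝ (Fin n)}, ‖N‖ = 1 → y = a + signedDistance Ω y • N →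
      dist y a = infDist y (frontier Ω) := by
    intro a N hN1 hya
    rw [dist_eq_norm, sub_eq_iff_eq_add'.2 hya, norm_smul, hN1, mul_one, Real.norm_eq_abs,
      abs_signedDistance]
  have hpq : p = q := (hz p ⟨hφ.mem_frontier, hdist (hφ.norm_unitNormal hφ.mem) hyp⟩).trans
    (hz q ⟨hψ.mem_frontier, hdist (hψ.norm_unitNormal hψ.mem) hyq⟩).symm
  subst hpq
  rw [hN, hN', hψ.unitNormal_eq hφ]

/-- The Riccati relation between the Hessians of the signed distance function at two points of a
normal segment. -/
theorem shapeOperator_add_smul (h : IsTube r ε Ω T) (hx : x ∈ T) {s : ℝ}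
    (hs : signedDistance Ω x + s < 0) (hsε : -ε < signedDistance Ω x + s)
    (v : EuclideanSpace ℝ (Fin n)) :
    shapeOperator Ω (x + s • outerNormal Ω x) (v + s • shapeOperator Ω x v) =
      shapeOperator Ω x v := by
  have hδ := h.signedDistance_add_smul hx hs hsε
  have hyT : x + s • outerNormal Ω x ∈ T :=
    h.mem _ (by rw [hδ]; exact hs.le) (by rw [hδ]; exact hsε)
  -- `h1` and `h2` differentiate the two sides of `N (y + s N y) = N y`.
  have h1 : HasFDerivAt (fun y => outerNormal Ω (y + s • outerNormal Ω y)) _ x :=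
    HasFDerivAt.comp (g := outerNormal Ω) (f := fun y => y + s • outerNormal Ω y) x
      (h.hasFDerivAt_outerNormal hyT) ((hasFDerivAt_id x).add ((h.hasFDerivAt_outerNormal hx).const_smul s))
  have h2 : HasFDerivAt (fun y => outerNormal Ω (y + s • outerNormal Ω y))
      (shapeOperator Ω x) x := by
    refine (h.hasFDerivAt_outerNormal hx).congr_of_eventuallyEq ?_
    have hc : ContinuousAt (fun y => signedDistance Ω y + s) x :=
      continuous_signedDistance.continuousAt.add continuousAt_const
    filter_upwards [h.isOpen.mem_nhds hx, hc.eventually (gt_mem_nhds hs),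
      hc.eventually (lt_mem_nhds hsε)] with y hy h1 h2
    exact h.outerNormal_add_smul hy h1 h2
  have := congrArg (fun L => L v) (h1.unique h2)
  simpa using this

/-- The nearest boundary point and its normal. -/
theorem exists_foot (h : IsTube r ε Ω T) (hε : 0 < ε) (hx : x ∈ T) :
    ∃ p ∈ frontier Ω, p ∈ T ∧ outerNormal Ω p = outerNormal Ω x ∧
      x = p + signedDistance Ω x • outerNormal Ω p := by
  obtain ⟨p, U, φ, hφ, hN, hxp⟩ := h.hasFoot x hx
  have hp0 : signedDistance Ω p = 0 := signedDistance_of_mem_frontier hφ.mem_frontier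
  have hpT : p ∈ T := h.mem p hp0.le (by rw [hp0]; linarith)
  obtain ⟨q, V, ψ, hψ, hN', hpq⟩ := h.hasFoot p hpT
  rw [hp0, zero_smul, add_zero] at hpq
  subst hpq
  have hpx : outerNormal Ω p = outerNormal Ω x := by rw [hN, hN', hψ.unitNormal_eq hφ]
  exact ⟨p, hφ.mem_frontier, hpT, hpx, by rwa [hpx, hN]⟩

theorem isLocalDefiningFunction (h : IsTube r ε Ω T) {D : Set (EuclideanSpace ℝ (Fin n))}
    (hD : ∀ y, y ∈ D ↔ signedDistance Ω y < signedDistance Ω x) (hx : x ∈ T) :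
    IsLocalDefiningFunction 2 D x T (fun y => signedDistance Ω y - signedDistance Ω x) where
  isOpen := h.isOpen
  mem := hx
  contDiffOn := (h.contDiffOn.of_le h.two_le).sub contDiffOn_const
  neg_iff y _ := by rw [hD, sub_neg]
  zero := sub_self _
  fderiv_ne_zero y hy := by
    rw [fderiv_sub_const, ← norm_ne_zero_iff, h.norm_fderiv hy]
    exact one_ne_zero

theorem fderiv_signedDistance_sub (c : ℝ) :
    fderiv ℝ (fun y => signedDistance Ω y - c) = fderiv ℝ (signedDistance Ω) := by
  funext y
  exact fderiv_sub_const c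

theorem secondFundamentalForm_signedDistance (h : IsTube r ε Ω T) (hx : x ∈ T) (c : ℝ)
    (v w : EuclideanSpace ℝ (Fin n)) :
    secondFundamentalForm (fun y => signedDistance Ω y - c) x v w =
      ⟪shapeOperator Ω x v, w⟫ := by
  rw [secondFundamentalForm, hess, fderiv_signedDistance_sub, h.norm_fderiv hx, div_one,
    inner_shapeOperator, hess]

end IsTube

end Tube

/-- The span of `n - 1` orthonormal vectors and of a unit vector orthogonal to them is the whole
space. -/
theorem exists_orthonormalBasis_option {n : ℕ} (hn : 0 < n)
    {v : Fin (n - 1) → EuclideanSpace ℝ (Fin n)} (hv : Orthonormal ℝ v)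
    {N : EuclideanSpace ℝ (Fin n)} (hN : ‖N‖ = 1) (hNv : ∀ i, inner ℝ N (v i) = 0) :
    ∃ b : OrthonormalBasis (Option (Fin (n - 1))) ℝ (EuclideanSpace ℝ (Fin n)),
      b none = N ∧ ∀ i, b (some i) = v i := by
  set u : Option (Fin (n - 1)) → EuclideanSpace ℝ (Fin n) := fun o => o.elim N v with hu
  have hor : Orthonormal ℝ u := by
    rw [orthonormal_iff_ite] at hv ⊢
    rintro (_ | i) (_ | j)
    · simp [hu, hN]
    · simpa [hu] using hNv j
    · simpa [hu, real_inner_comm] using hNv i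
    · simpa [hu] using hv i j
  have hcard : Fintype.card (Option (Fin (n - 1))) =
      Module.finrank ℝ (EuclideanSpace ℝ (Fin n)) := by
    simp; omega
  refine ⟨(basisOfOrthonormalOfCardEqFinrank hor hcard).toOrthonormalBasis (by simpa using hor),
    ?_, ?_⟩ <;> simp [hu]

/-! ### Principal curvatures of parallel hypersurfaces and traces of the Hessian -/

section Curvatures

open scoped RealInnerProductSpace

variable {n : ℕ} {Ω : Set (EuclideanSpace ℝ (Fin n))} {ε : ℝ} {r : WithTop ℕ∞}
  {T : Set (EuclideanSpace ℝ (Fin n))} {x : EuclideanSpace ℝ (Fin n)}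

/-- An orthonormal basis `v` of the tangent space at `x` of the level set of the signed distance
function which consists of principal directions, with principal curvatures `ν`. -/
structure IsCurvatureFrame (Ω : Set (EuclideanSpace ℝ (Fin n))) (x : EuclideanSpace ℝ (Fin n))
    (ν : Fin (n - 1) → ℝ) (v : Fin (n - 1) → EuclideanSpace ℝ (Fin n)) : Prop where
  orthonormal : Orthonormal ℝ v
  tangent : ∀ i, ⟪outerNormal Ω x, v i⟫ = 0
  eigen : ∀ i, shapeOperator Ω x (v i) = ν i • v i

namespace IsTube

/-- The second fundamental form is independent of the defining function, so `δ - δ x` may replace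
any other. Its gradient has length one and spans a null direction of its Hessian, so principal
directions become eigenvectors in the whole space. -/
theorem isPrincipalCurvatures_iff (h : IsTube r ε Ω T) (hn : 0 < n)
    {D : Set (EuclideanSpace ℝ (Fin n))}
    (hD : ∀ y, y ∈ D ↔ signedDistance Ω y < signedDistance Ω x) (hx : x ∈ T)
    {ν : Fin (n - 1) → ℝ} :
    IsPrincipalCurvatures D x ν ↔ Monotone ν ∧ ∃ v, IsCurvatureFrame Ω x ν v := by
  have hδ := h.isLocalDefiningFunction hD hx
  have hunit : unitNormal (fun y => signedDistance Ω y - signedDistance Ω x) x =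
      outerNormal Ω x := by
    rw [unitNormal, fderiv_signedDistance_sub, h.norm_fderiv hx, inv_one, one_smul, outerNormal]
  refine and_congr_right fun _ => ⟨?_, ?_⟩
  · rintro ⟨U, φ, hφ, v, hv, hvt, hvv⟩
    have hN : unitNormal φ x = outerNormal Ω x := (hφ.unitNormal_eq hδ).trans hunit
    have htan : ∀ i, ⟪outerNormal Ω x, v i⟫ = 0 := by
      intro i
      have := hφ.fderiv_apply_eq (v i)
      rw [hvt, hN] at this
      exact (mul_eq_zero.1 this.symm).resolve_left (hφ.norm_pos hφ.mem).ne'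
    refine ⟨v, hv, htan, fun i => ?_⟩
    obtain ⟨b, hb0, hb⟩ := exists_orthonormalBasis_option hn hv (h.norm_outerNormal hx) htan
    refine InnerProductSpace.ext_inner_right_basis b.toBasis fun o => ?_
    rw [b.coe_toBasis]
    rcases o with _ | j
    · rw [hb0, h.inner_shapeOperator_outerNormal hx, real_inner_smul_left, real_inner_comm, htan,
        mul_zero]
    · rw [hb, ← h.secondFundamentalForm_signedDistance hx (signedDistance Ω x),
        ← hφ.secondFundamentalForm_eq hδ (by rw [hN]; exact htan i) (by rw [hN]; exact htan j),
        hvv, real_inner_smul_left, orthonormal_iff_ite.1 hv]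
      simp
  · rintro ⟨v, hv, hvt, hvv⟩
    refine ⟨T, _, hδ, v, hv, fun i => ?_, fun i j => ?_⟩
    · rw [fderiv_signedDistance_sub, ← inner_outerNormal, hvt]
    · rw [h.secondFundamentalForm_signedDistance hx, hvv, real_inner_smul_left,
        orthonormal_iff_ite.1 hv]
      simp

section Riccati

variable {p : EuclideanSpace ℝ (Fin n)} {t a b : ℝ} {v : EuclideanSpace ℝ (Fin n)}

/-- If `1 + t * a = 0`, the Riccati relation applied to `v` reads `0 = a • v`, so `a = 0`, which is
absurd. -/
theorem one_add_mul_ne_zero (h : IsTube r ε Ω T) (hp : p ∈ T) (hp0 : signedDistance Ω p = 0)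
    (ht : t < 0) (htε : -ε < t) (hv : v ≠ 0) (ha : shapeOperator Ω p v = a • v) :
    1 + t * a ≠ 0 := by
  intro h0
  have := h.shapeOperator_add_smul hp (s := t) (by rwa [hp0, zero_add]) (by rwa [hp0, zero_add]) v
  rw [ha, smul_smul, show v + (t * a) • v = (1 + t * a) • v by rw [add_smul, one_smul], h0, zero_smul, map_zero] at this
  rw [(smul_eq_zero.1 this.symm).resolve_right hv] at h0
  simp at h0

/-- The principal curvatures of the boundary are less than `1 / |t|` if `|t| < ε`. -/
theorem one_add_mul_pos (h : IsTube r ε Ω T) (hp : p ∈ T) (hp0 : signedDistance Ω p = 0)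
    (ht : t < 0) (htε : -ε < t) (hv : v ≠ 0) (ha : shapeOperator Ω p v = a • v) :
    0 < 1 + t * a := by
  by_contra hle
  push Not at hle
  have ha0 : 0 < a := by
    by_contra hle'
    push Not at hle'
    nlinarith
  -- If `1 + t * a ≤ 0`, the zero `-a⁻¹` of `s ↦ 1 + s * a` lies in `[t, 0)`, where it is excluded.
  refine h.one_add_mul_ne_zero (t := -a⁻¹) hp hp0 (by simpa using ha0) ?_ hv ha (by field_simp; ring)
  refine htε.trans_le (le_neg.2 ?_)
  rw [inv_le_iff_one_le_mul₀ ha0]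
  linarith

theorem shapeOperator_of_foot (h : IsTube r ε Ω T) (hp : p ∈ T) (hp0 : signedDistance Ω p = 0)
    (ht : t < 0) (htε : -ε < t) (hv : v ≠ 0) (ha : shapeOperator Ω p v = a • v) :
    shapeOperator Ω (p + t • outerNormal Ω p) v = (a / (1 + t * a)) • v := by
  have h0 := h.one_add_mul_ne_zero hp hp0 ht htε hv ha
  have := h.shapeOperator_add_smul hp (s := t) (by rwa [hp0, zero_add]) (by rwa [hp0, zero_add]) v
  rw [ha, smul_smul, show v + (t * a) • v = (1 + t * a) • v by rw [add_smul, one_smul], map_smul] at this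
  rw [div_eq_inv_mul, mul_smul, ← this, inv_smul_smul₀ h0]

/-- Write `A_x`, `A_p` for the shape operators. In `t A_x A_p = A_p - A_x` the right side is
symmetric, so `A_x` and `A_p` commute; thus `t A_p A_x = A_p - A_x`, and an eigenvector at `x` is
one at the foot point. -/
theorem shapeOperator_foot (h : IsTube r ε Ω T) (hp : p ∈ T) (hp0 : signedDistance Ω p = 0)
    (ht : t < 0) (htε : -ε < t) (hv : v ≠ 0)
    (hb : shapeOperator Ω (p + t • outerNormal Ω p) v = b • v) :
    0 < 1 - t * b ∧ shapeOperator Ω p v = (b / (1 - t * b)) • v := by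
  have hs : signedDistance Ω p + t < 0 := by rwa [hp0, zero_add]
  have hsε : -ε < signedDistance Ω p + t := by rwa [hp0, zero_add]
  have hδ := h.signedDistance_add_smul hp hs hsε
  have hxT : p + t • outerNormal Ω p ∈ T :=
    h.mem _ (by rw [hδ]; exact hs.le) (by rw [hδ]; exact hsε)
  have hric := h.shapeOperator_add_smul hp hs hsε
  set x := p + t • outerNormal Ω p
  have key : ∀ w, t • shapeOperator Ω x (shapeOperator Ω p w) =
      shapeOperator Ω p w - shapeOperator Ω x w := by
    intro w
    have := hric w
    rw [map_add, map_smul] at this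
    rw [eq_sub_iff_add_eq', this]
  have hcomm : shapeOperator Ω x (shapeOperator Ω p v) =
      shapeOperator Ω p (shapeOperator Ω x v) := by
    refine ext_inner_right ℝ fun w => ?_
    rw [h.shapeOperator_symm hxT, h.shapeOperator_symm hp, h.shapeOperator_symm hp,
      h.shapeOperator_symm hxT]
    have h1 : ⟪t • shapeOperator Ω x (shapeOperator Ω p v), w⟫ =
        ⟪v, t • shapeOperator Ω x (shapeOperator Ω p w)⟫ := by
      rw [key, key, inner_sub_left, inner_sub_right, h.shapeOperator_symm hp,
        h.shapeOperator_symm hxT]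
    rw [real_inner_smul_left, real_inner_smul_right, h.shapeOperator_symm hxT,
      h.shapeOperator_symm hp] at h1
    exact mul_left_cancel₀ ht.ne h1
  have h1 := key v
  rw [hcomm, hb, map_smul] at h1
  have h2 : (1 - t * b) • shapeOperator Ω p v = b • v := by
    rw [sub_smul, one_smul, mul_smul, h1]
    abel
  have h3 : 1 - t * b ≠ 0 := by
    intro h0
    rw [h0, zero_smul] at h2
    rw [(smul_eq_zero.1 h2.symm).resolve_right hv] at h0
    simp at h0
  have h4 : shapeOperator Ω p v = (b / (1 - t * b)) • v := by
    rw [div_eq_inv_mul, mul_smul, ← h2, inv_smul_smul₀ h3]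
  refine ⟨?_, h4⟩
  have h5 := h.one_add_mul_pos hp hp0 ht htε hv h4
  have h6 : 1 + t * (b / (1 - t * b)) = (1 - t * b)⁻¹ := by field_simp; ring
  rw [h6] at h5
  exact inv_pos.1 h5

end Riccati

end IsTube

/-- Passing to a parallel hypersurface keeps the order of the curvatures, so the `m` smallest stay
the `m` smallest. -/
theorem monotone_div_one_add_mul {ι : Type*} [Preorder ι] {ν : ι → ℝ} (hν : Monotone ν) {t : ℝ}
    (hpos : ∀ i, 0 < 1 + t * ν i) : Monotone fun i => ν i / (1 + t * ν i) := by
  intro i j hij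
  have := hν hij
  simp only
  rw [div_le_div_iff₀ (hpos i) (hpos j)]
  linarith

/-- A weighted sum of an increasing sequence with weights in `[0, 1]` and total weight `m - c` is
almost as large as the sum of its `m` smallest terms. -/
theorem neg_mul_le_sum_mul {N m : ℕ} (hm : 0 < m) (hmN : m ≤ N) {ν w : Fin N → ℝ} {c C : ℝ}
    (hν : Monotone ν) (hw0 : ∀ j, 0 ≤ w j) (hw1 : ∀ j, w j ≤ 1) (hw : ∑ j, w j = m - c)
    (hc : 0 ≤ c) (hC : ∀ j, ν j ≤ C)
    (hsum : 0 ≤ ∑ j ∈ Finset.univ.filter (fun j : Fin N => (j : ℕ) < m), ν j) :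
    -(C * c) ≤ ∑ j, ν j * w j := by
  -- `ν k` is the `m`-th smallest value. With `χ` the indicator of `j < m`, each product `(ν j - ν
  -- k) * (w j - χ j)` is nonnegative; summing gives the bound `-(ν k * c)`.
  set k : Fin N := ⟨m - 1, by omega⟩ with hk
  have hcard : ∑ j : Fin N, (if (j : ℕ) < m then (1 : ℝ) else 0) = m := by
    rw [Finset.sum_boole, Fin.card_filter_val_lt, min_eq_right hmN]
  have hterm : ∀ j : Fin N, ν k * (w j - if (j : ℕ) < m then 1 else 0) ≤
      ν j * w j - if (j : ℕ) < m then ν j else 0 := by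
    intro j
    split_ifs with hj
    · have h1 : ν j ≤ ν k := hν (Fin.le_def.2 (by simp only [hk]; omega))
      nlinarith [hw1 j]
    · have h1 : ν k ≤ ν j := hν (Fin.le_def.2 (by simp only [hk]; omega))
      nlinarith [hw0 j]
  have h1 := Finset.sum_le_sum fun j (_ : j ∈ Finset.univ) => hterm j
  rw [← Finset.mul_sum, Finset.sum_sub_distrib, Finset.sum_sub_distrib, hcard, hw,
    ← Finset.sum_filter] at h1
  nlinarith [hC k]

/-- Lower bound for the trace of the Hessian of the signed distance function on a subspace. -/
theorem IsTube.neg_mul_le_traceHess (h : IsTube r ε Ω T) (hn : 0 < n) (hx : x ∈ T)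
    {m : ℕ} (hm : 0 < m) (hmn : m ≤ n - 1) {ν : Fin (n - 1) → ℝ} (hν : Monotone ν)
    {v : Fin (n - 1) → EuclideanSpace ℝ (Fin n)} (hv : IsCurvatureFrame Ω x ν v) {C : ℝ}
    (hC : ∀ j, ν j ≤ C)
    (hsum : 0 ≤ ∑ j ∈ Finset.univ.filter (fun j : Fin (n - 1) => (j : ℕ) < m), ν j)
    (L : Submodule ℝ (EuclideanSpace ℝ (Fin n))) (hL : Module.finrank ℝ L = m) :
    -(C * ∑ i, (fderiv ℝ (signedDistance Ω) x (stdOrthonormalBasis ℝ L i)) ^ 2) ≤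
      traceHess (signedDistance Ω) x L := by
  obtain ⟨b, hb0, hb⟩ := exists_orthonormalBasis_option hn hv.orthonormal
    (h.norm_outerNormal hx) hv.tangent
  set e : Fin (Module.finrank ℝ L) → EuclideanSpace ℝ (Fin n) :=
    fun i => (stdOrthonormalBasis ℝ L i : EuclideanSpace ℝ (Fin n)) with he
  have heo : Orthonormal ℝ e :=
    (stdOrthonormalBasis ℝ L).orthonormal.comp_linearIsometry L.subtypeₗᵢ
  have hess_eq : ∀ z, hess (signedDistance Ω) x z z = ∑ j, ν j * ⟪v j, z⟫ ^ 2 := by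
    intro z
    rw [← inner_shapeOperator, ← b.sum_inner_mul_inner, Fintype.sum_option, hb0,
      h.inner_shapeOperator_outerNormal hx, zero_mul, zero_add]
    refine Finset.sum_congr rfl fun j _ => ?_
    rw [hb, h.shapeOperator_symm hx, hv.eigen, real_inner_smul_right, real_inner_comm z (v j)]
    ring
  have htrace : traceHess (signedDistance Ω) x L = ∑ j, ν j * ∑ i, ⟪v j, e i⟫ ^ 2 := by
    rw [traceHess]
    simp only [hess_eq, Finset.mul_sum]
    exact Finset.sum_comm
  have hpars : ∀ i, ⟪outerNormal Ω x, e i⟫ ^ 2 + ∑ j, ⟪v j, e i⟫ ^ 2 = 1 := by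
    intro i
    have := b.sum_sq_norm_inner_right (e i)
    rw [heo.1 i, Fintype.sum_option, hb0] at this
    simpa [hb] using this
  rw [htrace]
  simp only [← inner_outerNormal]
  -- The weight of `ν j` is the squared length of the projection of `v j` to `L`: at most `1` by
  -- Bessel. By Parseval the weights add up to `m` minus the squared normal components of the `e i`.
  refine neg_mul_le_sum_mul hm hmn hν (fun j => Finset.sum_nonneg fun i _ => sq_nonneg _) ?_ ?_
    (Finset.sum_nonneg fun i _ => sq_nonneg _) hC hsum
  · intro j
    have := heo.sum_inner_products_le (v j) (s := Finset.univ)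
    rw [hv.orthonormal.1 j] at this
    simpa [real_inner_comm] using this
  · have h1 := Finset.sum_congr rfl fun i (_ : i ∈ Finset.univ) => hpars i
    rw [Finset.sum_add_distrib, Finset.sum_comm] at h1
    simp only [Finset.sum_const, Finset.card_univ, Fintype.card_fin, nsmul_eq_mul, mul_one,
      hL] at h1
    linarith

/-- The Hessian of a composition with a function of one variable. -/
theorem hess_comp {g g' : ℝ → ℝ} {g'' : ℝ} {f : EuclideanSpace ℝ (Fin n) → ℝ}
    (hf : ContDiffAt ℝ 2 f x) (hg : ∀ y, HasDerivAt g (g' y) y) (hg' : HasDerivAt g' g'' (f x))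
    (v w : EuclideanSpace ℝ (Fin n)) :
    hess (fun y => g (f y)) x v w =
      g' (f x) * hess f x v w + g'' * fderiv ℝ f x v * fderiv ℝ f x w := by
  have h1 : fderiv ℝ (fun y => g (f y)) =ᶠ[𝓝 x] fun y => g' (f y) • fderiv ℝ f y := by
    filter_upwards [hf.eventually (by simp)] with y hy
    exact ((hg (f y)).comp_hasFDerivAt y
      (hy.differentiableAt (by norm_num)).hasFDerivAt).fderiv
  have h2 : HasFDerivAt (fderiv ℝ f) (fderiv ℝ (fderiv ℝ f) x) x :=
    ((hf.fderiv_right (m := 1) (by norm_num)).differentiableAt (by norm_num)).hasFDerivAt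
  have h3 := (hg'.comp_hasFDerivAt x (hf.differentiableAt (by norm_num)).hasFDerivAt).smul h2
  have h4 : HasFDerivAt (fun y => g' (f y) • fderiv ℝ f y) _ x := h3
  rw [hess, h1.fderiv_eq, h4.fderiv]
  simp [hess]

end Curvatures

/-! ### The convex profile -/

section Profile

/-- A smooth increasing convex function on `(-∞, 0]` which is constant on `(-∞, -c]` and satisfies
`g'' ≥ C g'`. -/
structure IsProfile (C c : ℝ) (g g' g'' : ℝ → ℝ) : Prop where
  contDiff : ∀ k : ℕ∞, ContDiff ℝ k g
  hasDerivAt : ∀ y, HasDerivAt g (g' y) y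
  hasDerivAt' : ∀ y, HasDerivAt g' (g'' y) y
  zero : g 0 = 0
  eq_neg_one : ∀ y ≤ -c, g y = -1
  strictMonoOn : StrictMonoOn g (Ici (-c))
  deriv_pos : ∀ y, -c < y → 0 < g' y
  deriv_nonneg : ∀ y, 0 ≤ g' y
  le_deriv2 : ∀ y ≤ 0, C * g' y ≤ g'' y

open Polynomial in
-- Take `g y = a * exp (-1 / (y + c)) - 1` for `y > -c`. With `k = 1 / (y + c)` one has `g'' = (k² -
-- 2k) g'`, and `y ≤ 0` gives `k ≥ 1 / c = C + 2`, whence `k² - 2k ≥ C (C + 2) ≥ C`.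
theorem exists_isProfile {C : ℝ} (hC : 0 ≤ C) :
    ∃ g g' g'', IsProfile C (C + 2)⁻¹ g g' g'' := by
  set c := (C + 2)⁻¹ with hc
  have hc0 : 0 < c := by positivity
  set a := (expNegInvGlue c)⁻¹ with ha
  have hgc := expNegInvGlue.pos_of_pos hc0
  have ha0 : 0 < a := by positivity
  have hE1 : ∀ y, HasDerivAt expNegInvGlue ((y⁻¹) ^ 2 * expNegInvGlue y) y := by
    intro y
    have := expNegInvGlue.hasDerivAt_polynomial_eval_inv_mul 1 y
    simpa using this
  have hE2 : ∀ y, HasDerivAt (fun y => (y⁻¹) ^ 2 * expNegInvGlue y)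
      ((y⁻¹) ^ 2 * ((y⁻¹) ^ 2 - 2 * y⁻¹) * expNegInvGlue y) y := by
    intro y
    have := expNegInvGlue.hasDerivAt_polynomial_eval_inv_mul (X ^ 2) y
    simpa [one_add_one_eq_two] using this
  have hg : ∀ y, HasDerivAt (fun y => expNegInvGlue (y + c) * a - 1)
      (((y + c)⁻¹) ^ 2 * expNegInvGlue (y + c) * a) y := fun y =>
    (((hE1 (y + c)).comp_add_const y c).mul_const a).sub_const 1
  have hpos : ∀ y, -c < y → 0 < ((y + c)⁻¹) ^ 2 * expNegInvGlue (y + c) * a := by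
    intro y hy
    have h1 : 0 < y + c := by linarith
    have := expNegInvGlue.pos_of_pos h1
    positivity
  refine ⟨fun y => expNegInvGlue (y + c) * a - 1,
    fun y => ((y + c)⁻¹) ^ 2 * expNegInvGlue (y + c) * a,
    fun y => ((y + c)⁻¹) ^ 2 * (((y + c)⁻¹) ^ 2 - 2 * (y + c)⁻¹) * expNegInvGlue (y + c) * a,
    ?_, hg, ?_, ?_, ?_, ?_, hpos, ?_, ?_⟩
  · intro k
    have h1 : ContDiff ℝ k expNegInvGlue := expNegInvGlue.contDiff
    exact ((h1.comp (contDiff_id.add contDiff_const)).mul contDiff_const).sub contDiff_const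
  · exact fun y => ((hE2 (y + c)).comp_add_const y c).mul_const a
  · rw [zero_add, ha, mul_inv_cancel₀ hgc.ne', sub_self]
  · intro y hy
    rw [expNegInvGlue.zero_of_nonpos (by linarith)]
    ring
  · refine strictMonoOn_of_deriv_pos (convex_Ici _)
      (fun y _ => (hg y).continuousAt.continuousWithinAt) fun y hy => ?_
    rw [interior_Ici] at hy
    rw [(hg y).deriv]
    exact hpos y hy
  · intro y
    have := expNegInvGlue.nonneg (y + c)
    positivity
  · intro y hy
    rcases le_or_gt (y + c) 0 with h | h
    · rw [expNegInvGlue.zero_of_nonpos h]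
      simp
    · have h1 : C + 2 ≤ (y + c)⁻¹ := by
        rw [le_inv_comm₀ (by linarith) h, ← hc]
        linarith
      set k := (y + c)⁻¹
      have h2 : C ≤ k ^ 2 - 2 * k := by nlinarith
      have h3 : 0 ≤ k ^ 2 * expNegInvGlue (y + c) * a :=
        mul_nonneg (mul_nonneg (sq_nonneg _) (expNegInvGlue.nonneg _)) ha0.le
      nlinarith [mul_le_mul_of_nonneg_right h2 h3]

namespace IsProfile

variable {C c : ℝ} {g g' g'' : ℝ → ℝ}

theorem monotone (h : IsProfile C c g g' g'') : Monotone g := by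
  refine monotone_of_deriv_nonneg (fun y => (h.hasDerivAt y).differentiableAt) fun y => ?_
  rw [(h.hasDerivAt y).deriv]
  exact h.deriv_nonneg y

theorem neg_one_lt_iff (h : IsProfile C c g g' g'') {y : ℝ} : -1 < g y ↔ -c < y := by
  refine ⟨fun hy => ?_, fun hy => ?_⟩
  · by_contra hle
    exact hy.ne' (h.eq_neg_one y (not_lt.1 hle))
  · rw [← h.eq_neg_one (-c) le_rfl]
    exact h.strictMonoOn self_mem_Ici hy.le hy

theorem lt_iff (h : IsProfile C c g g' g'') {y z : ℝ} (hz : -c < z) : g y < g z ↔ y < z := by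
  refine ⟨fun hy => h.monotone.reflect_lt hy, fun hy => ?_⟩
  rcases le_or_gt y (-c) with hyc | hyc
  · rw [h.eq_neg_one y hyc]
    exact h.neg_one_lt_iff.2 hz
  · exact h.strictMonoOn hyc.le hz.le hy

theorem exists_eq (h : IsProfile C c g g' g'') (hc : 0 < c) {t : ℝ} (ht : -1 < t) (ht0 : t < 0) :
    ∃ y, -c < y ∧ y < 0 ∧ g y = t := by
  have hcont : ContinuousOn g (Icc (-c) 0) :=
    fun y _ => (h.hasDerivAt y).continuousAt.continuousWithinAt
  obtain ⟨y, hy, hyt⟩ := intermediate_value_Ioo (by linarith : -c ≤ 0) hcont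
    (show t ∈ Ioo (g (-c)) (g 0) by rw [h.eq_neg_one _ le_rfl, h.zero]; exact ⟨ht, ht0⟩)
  exact ⟨y, hy.1, hy.2, hyt⟩

end IsProfile

end Profile

/-! ### Convexity and flatness of the level sets -/

section Levels

open scoped RealInnerProductSpace

variable {m n : ℕ} {Ω D : Set (EuclideanSpace ℝ (Fin n))} {ε : ℝ} {r : WithTop ℕ∞}
  {T : Set (EuclideanSpace ℝ (Fin n))} {x p : EuclideanSpace ℝ (Fin n)}

/-- Each term gains `-t ν² / (1 + t ν) ≥ 0`, with equality only for `ν = 0`. -/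
theorem sum_filter_le_sum_div {N : ℕ} {ν : Fin N → ℝ} {t : ℝ} (ht : t < 0)
    (hpos : ∀ i, 0 < 1 + t * ν i) (s : Finset (Fin N)) :
    ∑ j ∈ s, ν j ≤ ∑ j ∈ s, ν j / (1 + t * ν j) := by
  refine Finset.sum_le_sum fun j _ => ?_
  rw [le_div_iff₀ (hpos j)]
  nlinarith [sq_nonneg (ν j)]

theorem sum_filter_lt_sum_div {N : ℕ} {ν : Fin N → ℝ} {t : ℝ} (ht : t < 0)
    (hpos : ∀ i, 0 < 1 + t * ν i) {s : Finset (Fin N)} {i : Fin N} (hi : i ∈ s) (hνi : ν i ≠ 0) :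
    ∑ j ∈ s, ν j < ∑ j ∈ s, ν j / (1 + t * ν j) := by
  refine Finset.sum_lt_sum (fun j _ => ?_) ⟨i, hi, ?_⟩
  · rw [le_div_iff₀ (hpos j)]
    nlinarith [sq_nonneg (ν j)]
  · rw [lt_div_iff₀ (hpos i)]
    have : 0 < ν i ^ 2 := by positivity
    nlinarith

namespace IsTube

theorem mem_iff_of_mem_frontier (h : IsTube r ε Ω T) (hp : p ∈ frontier Ω)
    (y : EuclideanSpace ℝ (Fin n)) : y ∈ Ω ↔ signedDistance Ω y < signedDistance Ω p := by
  rw [signedDistance_of_mem_frontier hp,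
    signedDistance_neg_iff h.isOpen_domain h.nonempty_frontier]

/-- A curvature frame at a boundary point is a curvature frame along the inner normal. -/
theorem frame_of_foot (h : IsTube r ε Ω T) (hp : p ∈ T) (hp0 : signedDistance Ω p = 0) {t : ℝ}
    (ht : t < 0) (htε : -ε < t) {ν : Fin (n - 1) → ℝ}
    {v : Fin (n - 1) → EuclideanSpace ℝ (Fin n)} (hv : IsCurvatureFrame Ω p ν v) :
    IsCurvatureFrame Ω (p + t • outerNormal Ω p) (fun i => ν i / (1 + t * ν i)) v where
  orthonormal := hv.orthonormal
  tangent i := by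
    rw [h.outerNormal_add_smul hp (by rwa [hp0, zero_add]) (by rwa [hp0, zero_add])]
    exact hv.tangent i
  eigen i := h.shapeOperator_of_foot hp hp0 ht htε (hv.orthonormal.ne_zero i) (hv.eigen i)

theorem frame_foot (h : IsTube r ε Ω T) (hp : p ∈ T) (hp0 : signedDistance Ω p = 0) {t : ℝ}
    (ht : t < 0) (htε : -ε < t) {ν : Fin (n - 1) → ℝ}
    {v : Fin (n - 1) → EuclideanSpace ℝ (Fin n)}
    (hv : IsCurvatureFrame Ω (p + t • outerNormal Ω p) ν v) :
    (∀ i, 0 < 1 + -t * ν i) ∧ IsCurvatureFrame Ω p (fun i => ν i / (1 + -t * ν i)) v := by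
  have key := fun i => h.shapeOperator_foot hp hp0 ht htε (hv.orthonormal.ne_zero i) (hv.eigen i)
  -- This sign convention makes `monotone_div_one_add_mul` applicable with `-t` in place of `t`.
  have heq : ∀ i, 1 - t * ν i = 1 + -t * ν i := fun i => by ring
  simp only [heq] at key
  refine ⟨fun i => (key i).1, hv.orthonormal, fun i => ?_, fun i => (key i).2⟩
  have := hv.tangent i
  rwa [h.outerNormal_add_smul hp (by rwa [hp0, zero_add]) (by rwa [hp0, zero_add])] at this

/-- The principal curvatures of an inner parallel hypersurface of an `m`-convex hypersurface. -/
theorem exists_frame (h : IsTube r ε Ω T) (hε : 0 < ε) (hn : 0 < n)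
    (hconv : ∀ p ∈ frontier Ω, IsMConvexAt m Ω p)
    (hx : signedDistance Ω x < 0) (hxε : -ε < signedDistance Ω x) :
    ∃ (ν : Fin (n - 1) → ℝ) (v : Fin (n - 1) → EuclideanSpace ℝ (Fin n)), Monotone ν ∧
      (∀ s, s < 0 → -ε < s → ∀ i, 0 < 1 + s * ν i) ∧
      IsCurvatureFrame Ω x (fun i => ν i / (1 + signedDistance Ω x * ν i)) v ∧
      0 ≤ ∑ j ∈ Finset.univ.filter (fun j : Fin (n - 1) => (j : ℕ) < m), ν j := by
  obtain ⟨p, hp, hpT, -, hxp⟩ := h.exists_foot hε (h.mem x hx.le hxε)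
  have hp0 := signedDistance_of_mem_frontier hp
  obtain ⟨ν, hν, hsum⟩ := hconv p hp
  obtain ⟨hmono, v, hv⟩ := (h.isPrincipalCurvatures_iff hn (h.mem_iff_of_mem_frontier hp) hpT).1 hν
  refine ⟨ν, v, hmono, fun s hs hsε i =>
    h.one_add_mul_pos hpT hp0 hs hsε (hv.orthonormal.ne_zero i) (hv.eigen i), ?_, hsum⟩
  have := h.frame_of_foot hpT hp0 hx hxε hv
  rwa [← hxp] at this

theorem isMConvexAt_level (h : IsTube r ε Ω T) (hε : 0 < ε) (hn : 0 < n)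
    (hconv : ∀ p ∈ frontier Ω, IsMConvexAt m Ω p)
    (hx : signedDistance Ω x < 0) (hxε : -ε < signedDistance Ω x)
    (hD : ∀ y, y ∈ D ↔ signedDistance Ω y < signedDistance Ω x) : IsMConvexAt m D x := by
  obtain ⟨ν, v, hmono, hpos, hv, hsum⟩ := h.exists_frame hε hn hconv hx hxε
  exact ⟨_, (h.isPrincipalCurvatures_iff hn hD (h.mem x hx.le hxε)).2
    ⟨monotone_div_one_add_mul hmono (hpos _ hx hxε), v, hv⟩,
    hsum.trans (sum_filter_le_sum_div hx (hpos _ hx hxε) _)⟩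

/-- If the `m` smallest curvatures at the foot point vanished, so would those at `x`. Hence one of
them is nonzero and the gain in the sum is strict. -/
theorem isStronglyMConvexAt_level (h : IsTube r ε Ω T) (hε : 0 < ε) (hn : 0 < n)
    (hconv : ∀ p ∈ frontier Ω, IsMConvexAt m Ω p)
    (hx : signedDistance Ω x < 0) (hxε : -ε < signedDistance Ω x)
    (hD : ∀ y, y ∈ D ↔ signedDistance Ω y < signedDistance Ω x) (hflat : ¬ IsMFlatAt m D x) :
    IsStronglyMConvexAt m D x := by
  obtain ⟨ν, v, hmono, hpos, hv, hsum⟩ := h.exists_frame hε hn hconv hx hxε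
  have hcurv := (h.isPrincipalCurvatures_iff hn hD (h.mem x hx.le hxε)).2
    ⟨monotone_div_one_add_mul hmono (hpos _ hx hxε), v, hv⟩
  obtain ⟨i, him, hi⟩ : ∃ i : Fin (n - 1), (i : ℕ) < m ∧ ν i ≠ 0 := by
    by_contra hcon
    push Not at hcon
    exact hflat ⟨_, hcurv, fun j hj => by rw [hcon j hj, zero_div]⟩
  exact ⟨_, hcurv, hsum.trans_lt (sum_filter_lt_sum_div hx (hpos _ hx hxε) (by simpa using him) hi)⟩

theorem isMFlatAt_foot (h : IsTube r ε Ω T) (hn : 0 < n) (hp : p ∈ frontier Ω) (hpT : p ∈ T)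
    {t : ℝ} (ht : t < 0) (htε : -ε < t) (hD : ∀ y, y ∈ D ↔ signedDistance Ω y < t)
    (hflat : IsMFlatAt m D (p + t • outerNormal Ω p)) : IsMFlatAt m Ω p := by
  have hp0 := signedDistance_of_mem_frontier hp
  have hδ := h.signedDistance_add_smul hpT (s := t) (by rwa [hp0, zero_add])
    (by rwa [hp0, zero_add])
  rw [hp0, zero_add] at hδ
  obtain ⟨ν, hν, hν0⟩ := hflat
  obtain ⟨hmono, v, hv⟩ := (h.isPrincipalCurvatures_iff hn (by rwa [hδ])
    (h.mem _ (by rw [hδ]; exact ht.le) (by rwa [hδ]))).1 hν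
  obtain ⟨hpos, hv'⟩ := h.frame_foot hpT hp0 ht htε hv
  exact ⟨_, (h.isPrincipalCurvatures_iff hn (h.mem_iff_of_mem_frontier hp) hpT).2
    ⟨monotone_div_one_add_mul hmono hpos, v, hv'⟩, fun j hj => by rw [hν0 j hj, zero_div]⟩

theorem frontier_sublevel (h : IsTube r ε Ω T) {t : ℝ} (ht : t ≤ 0) (htε : -ε < t)
    (hD : ∀ y, y ∈ D ↔ signedDistance Ω y < t) : frontier D = {x | signedDistance Ω x = t} := by
  have hDeq : D = {y | signedDistance Ω y < t} := Set.ext hD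
  refine Subset.antisymm ?_ fun x hx => ?_
  · rw [hDeq]
    exact frontier_lt_subset_eq continuous_signedDistance continuous_const
  · replace hx : signedDistance Ω x = t := hx
    exact (h.isLocalDefiningFunction (by rwa [hx])
      (h.mem x (by rwa [hx]) (by rwa [hx]))).mem_frontier

/-- Since `q ↦ q + t N q` is continuous from the boundary to the level set, the foot point of an
interior flat point is an interior flat point of the boundary, at distance `-t`; thickening keeps
the set bounded. -/
theorem notMFlatAtInfinity_sublevel (h : IsTube r ε Ω T) (hε : 0 < ε) (hn : 0 < n)
    (hflat : NotMFlatAtInfinity m Ω) {t : ℝ} (ht : t < 0) (htε : -ε < t)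
    (hD : ∀ y, y ∈ D ↔ signedDistance Ω y < t) : NotMFlatAtInfinity m D := by
  have hfr := h.frontier_sublevel ht.le htε hD
  refine (Bornology.IsBounded.cthickening (δ := -t) hflat).subset ?_
  rintro _ ⟨⟨x, hxD⟩, hx, rfl⟩
  have hxt : signedDistance Ω x = t := by rw [hfr] at hxD; exact hxD
  obtain ⟨p, hp, hpT, hN, hxp⟩ :=
    h.exists_foot hε (h.mem x (by rw [hxt]; exact ht.le) (by rwa [hxt]))
  rw [hxt] at hxp
  refine mem_cthickening_of_dist_le x p (-t) _ ⟨⟨p, hp⟩, ?_, rfl⟩ ?_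
  · rw [mem_interior_iff_mem_nhds, mem_nhds_subtype] at hx ⊢
    obtain ⟨O, hO, hOsub⟩ := hx
    have hc : ContinuousAt (fun q => q + t • outerNormal Ω q) p :=
      continuousAt_id.add ((h.hasFDerivAt_outerNormal hpT).continuousAt.const_smul t)
    refine ⟨T ∩ {q | q + t • outerNormal Ω q ∈ O},
      Filter.inter_mem (h.isOpen.mem_nhds hpT) (hc (show O ∈ 𝓝 (p + t • outerNormal Ω p) by rwa [← hxp])), ?_⟩
    rintro ⟨q, hq⟩ ⟨hqT, hqO⟩
    have hq0 := signedDistance_of_mem_frontier hq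
    have hδ := h.signedDistance_add_smul hqT (s := t) (by rwa [hq0, zero_add])
      (by rwa [hq0, zero_add])
    rw [hq0, zero_add] at hδ
    have hyD : q + t • outerNormal Ω q ∈ frontier D := by rw [hfr]; exact hδ
    exact h.isMFlatAt_foot hn hq hqT ht htε hD
      (hOsub (show (⟨_, hyD⟩ : frontier D) ∈ Subtype.val ⁻¹' O from hqO))
  · rw [dist_eq_norm, sub_eq_iff_eq_add'.2 hxp, norm_smul, h.norm_outerNormal hpT, mul_one,
      Real.norm_eq_abs, abs_of_neg ht]

/-- The composition of the signed distance function with a profile is `m`-plurisubharmonic in the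
tube. -/
theorem traceHess_comp_nonneg (h : IsTube r ε Ω T) (hε : 0 < ε) (hn : 0 < n) (hm : 0 < m)
    (hmn : m ≤ n - 1) (hconv : ∀ p ∈ frontier Ω, IsMConvexAt m Ω p)
    (hx : signedDistance Ω x < 0) (hxε : -(ε / 2) ≤ signedDistance Ω x) {c : ℝ}
    {g g' g'' : ℝ → ℝ} (hg : IsProfile (2 / ε) c g g' g'')
    (L : Submodule ℝ (EuclideanSpace ℝ (Fin n))) (hL : Module.finrank ℝ L = m) :
    0 ≤ traceHess (fun y => g (signedDistance Ω y)) x L := by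
  have hxε' : -ε < signedDistance Ω x := by linarith
  have hxT := h.mem x hx.le hxε'
  obtain ⟨ν, v, hmono, hpos, hv, hsum⟩ := h.exists_frame hε hn hconv hx hxε'
  have hposx := hpos _ hx hxε'
  have hC : ∀ j, ν j / (1 + signedDistance Ω x * ν j) ≤ 2 / ε := by
    intro j
    rcases le_or_gt (ν j) 0 with hj | hj
    · exact (div_nonpos_of_nonpos_of_nonneg hj (hposx j).le).trans (by positivity)
    -- Otherwise `s = -1 / ν j` would lie in `(-ε, 0)` and make `1 + s * ν j` vanish. With `δ x ≥ -ε
    -- / 2`, this bound gives the constant `2 / ε`.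
    · have h1 : ν j * ε ≤ 1 := by
        by_contra hlt
        push Not at hlt
        have := hpos (-(ν j)⁻¹) (by simpa using hj) (by
          rw [neg_lt_neg_iff, inv_lt_iff_one_lt_mul₀ hj]
          linarith) j
        rw [neg_mul, inv_mul_cancel₀ hj.ne'] at this
        simp at this
      rw [div_le_div_iff₀ (hposx j) hε]
      nlinarith
  have htr := h.neg_mul_le_traceHess hn hxT hm hmn (monotone_div_one_add_mul hmono hposx)
    hv hC (hsum.trans (sum_filter_le_sum_div hx hposx _)) L hL
  have hcomp : traceHess (fun y => g (signedDistance Ω y)) x L =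
      g' (signedDistance Ω x) * traceHess (signedDistance Ω) x L + g'' (signedDistance Ω x) *
        ∑ i, (fderiv ℝ (signedDistance Ω) x (stdOrthonormalBasis ℝ L i)) ^ 2 := by
    simp only [traceHess, hess_comp (h.contDiffAt hxT) hg.hasDerivAt (hg.hasDerivAt' _),
      Finset.sum_add_distrib, Finset.mul_sum]
    congr 1
    exact Finset.sum_congr rfl fun i _ => by ring
  have hS : 0 ≤ ∑ i, (fderiv ℝ (signedDistance Ω) x (stdOrthonormalBasis ℝ L i)) ^ 2 :=
    Finset.sum_nonneg fun i _ => sq_nonneg _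
  rw [hcomp]
  nlinarith [mul_le_mul_of_nonneg_left htr (hg.deriv_nonneg (signedDistance Ω x)),
    mul_le_mul_of_nonneg_right (hg.le_deriv2 _ hx.le) hS]

end IsTube

theorem traceHess_of_eventuallyEq_const {f : EuclideanSpace ℝ (Fin n) → ℝ} {a : ℝ}
    (hf : ∀ᶠ y in 𝓝 x, f y = a) (L : Submodule ℝ (EuclideanSpace ℝ (Fin n))) :
    traceHess f x L = 0 := by
  have h1 : fderiv ℝ f =ᶠ[𝓝 x] fun _ => 0 := by
    filter_upwards [hf.eventually_nhds] with y hy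
    rw [Filter.EventuallyEq.fderiv_eq (f := fun _ => a) hy, fderiv_fun_const, Pi.zero_apply]
  have h2 : fderiv ℝ (fderiv ℝ f) x = 0 := by
    rw [h1.fderiv_eq, fderiv_fun_const, Pi.zero_apply]
  simp [traceHess, hess, h2]

end Levels

theorem signedDistance_eq_zero_of_frontier_eq_empty {n : ℕ} {Ω : Set (EuclideanSpace ℝ (Fin n))}
    (h : frontier Ω = ∅) (x : EuclideanSpace ℝ (Fin n)) : signedDistance Ω x = 0 := by
  rw [← abs_eq_zero, abs_signedDistance, h, infDist_empty]

end MConvex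

/-! ### Construction of the defining function -/

theorem proposition3p2 (m n : ℕ) (hm : 2 ≤ m) (hmn : m < n)
    (r : ℕ∞) (hr : 2 ≤ r)
    (Ω : Set (EuclideanSpace ℝ (Fin n))) (hΩ_open : IsOpen Ω) (hΩ_conn : IsConnected Ω)
    (hΩ_bdry : MConvex.HasBoundaryOfClass (r : WithTop ℕ∞) Ω)
    (hΩ_convex : ∀ p ∈ frontier Ω, MConvex.IsMConvexAt m Ω p)
    (hΩ_flat : MConvex.NotMFlatAtInfinity m Ω)
    (ε : ℝ) (hε : 0 < ε) (hΩ_reach : MConvex.HasUniqueNearestPoints ε (frontier Ω)) :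
    ∃ ρ : EuclideanSpace ℝ (Fin n) → ℝ,
      -- `ρ` is of class `C^r` up to the boundary, on a neighbourhood of the closure of `Ω`
      (∃ W : Set (EuclideanSpace ℝ (Fin n)), IsOpen W ∧ closure Ω ⊆ W ∧
        ContDiffOn ℝ (r : WithTop ℕ∞) ρ W) ∧
      (∀ x ∈ closure Ω, ρ x ≤ 0) ∧
      MConvex.IsMPlurisubharmonicOn m ρ Ω ∧
      (∀ x ∈ frontier Ω, ρ x = 0) ∧
      (∀ x ∈ closure Ω, -1 < ρ x → ρ x ≤ 0 → fderiv ℝ ρ x ≠ 0) ∧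
      ∀ t : ℝ, -1 < t → t < 0 →
        -- the level set of `ρ` is a level set of the signed distance function
        (∃ τ : ℝ, -ε < τ ∧ τ < 0 ∧
          {x | x ∈ closure Ω ∧ ρ x = t} = {x | MConvex.signedDistance Ω x = τ}) ∧
        -- it is the boundary of the sublevel set of `ρ`, which gives its orientation
        {x | x ∈ closure Ω ∧ ρ x = t} = frontier {x | x ∈ Ω ∧ ρ x < t} ∧
        (∀ x ∈ closure Ω, ρ x = t → MConvex.IsMConvexAt m {y | y ∈ Ω ∧ ρ y < t} x) ∧
        (∀ x ∈ closure Ω, ρ x = t → ¬ MConvex.IsMFlatAt m {y | y ∈ Ω ∧ ρ y < t} x →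
          MConvex.IsStronglyMConvexAt m {y | y ∈ Ω ∧ ρ y < t} x) ∧
        MConvex.NotMFlatAtInfinity m {y | y ∈ Ω ∧ ρ y < t} := by
  have hn : 0 < n := by omega
  rcases (frontier Ω).eq_empty_or_nonempty with hemp | hne
  -- Without boundary, `infDist` to the empty set is `0` by convention, so `δ` carries no
  -- information. The constant `-1` works: all the level sets concerned are empty.
  · have hno : ∀ t : ℝ, -1 < t → {y | y ∈ Ω ∧ (-1 : ℝ) < t} = Ω := fun t ht => by simp [ht]
    refine ⟨fun _ => -1, ⟨univ, isOpen_univ, subset_univ _, contDiffOn_const⟩,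
      fun _ _ => by norm_num, ⟨contDiffOn_const, fun x _ L _ => ?_⟩, by simp [hemp],
      fun x _ h => absurd h (lt_irrefl _), fun t ht ht0 => ?_⟩
    · exact (MConvex.traceHess_of_eventuallyEq_const (Filter.Eventually.of_forall fun _ => rfl)
        L).ge
    · rw [hno t ht, hemp]
      have hlev : {x | x ∈ closure Ω ∧ (-1 : ℝ) = t} = ∅ := by simp [ht.ne]
      refine ⟨⟨-(ε / 2), by linarith, by linarith, ?_⟩, hlev, fun _ _ h => absurd h ht.ne,
        fun _ _ h => absurd h ht.ne, hΩ_flat⟩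
      rw [hlev]
      refine (eq_empty_of_forall_notMem fun x hx => ?_).symm
      have hx : MConvex.signedDistance Ω x = -(ε / 2) := hx
      rw [MConvex.signedDistance_eq_zero_of_frontier_eq_empty hemp] at hx
      linarith
  obtain ⟨k, hk, rfl⟩ : ∃ k : ℕ∞, 1 ≤ k ∧ r = k + 1 :=
    ⟨r - 1, tsub_le_tsub_right hr 1,
      (tsub_add_cancel_of_le (one_le_two.trans hr)).symm⟩
  have hcast : ((k + 1 : ℕ∞) : WithTop ℕ∞) = (k : WithTop ℕ∞) + 1 := by push_cast; rfl
  rw [hcast] at hΩ_bdry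
  obtain ⟨T, hT⟩ := MConvex.exists_isTube hk hΩ_open hΩ_bdry hΩ_reach hne
  obtain ⟨g, g', g'', hg⟩ := MConvex.exists_isProfile (C := 2 / ε) (by positivity)
  set c := (2 / ε + 2)⁻¹ with hc
  have hc0 : 0 < c := by positivity
  -- Wherever `ρ > -1`, the depth is below `ε / 2`, so the curvature bound `2 / ε` is available.
  have hcε : c ≤ ε / 2 := by
    rw [hc, inv_le_comm₀ (by positivity) (by positivity), inv_div]
    linarith
  have hδcont := MConvex.continuous_signedDistance (Ω := Ω)
  have hneg : ∀ {x}, MConvex.signedDistance Ω x < 0 ↔ x ∈ Ω :=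
    MConvex.signedDistance_neg_iff hΩ_open hne
  have hclos : ∀ x ∈ closure Ω, MConvex.signedDistance Ω x ≤ 0 := by
    intro x hx
    by_cases hxΩ : x ∈ Ω
    · exact (hneg.2 hxΩ).le
    · exact (MConvex.signedDistance_of_mem_frontier (by rw [hΩ_open.frontier_eq]; exact ⟨hx, hxΩ⟩)).le
  have hconst : ∀ x, MConvex.signedDistance Ω x < -c →
      ∀ᶠ y in 𝓝 x, g (MConvex.signedDistance Ω y) = -1 := fun x hx =>
    (hδcont.continuousAt.eventually (gt_mem_nhds hx)).mono fun y hy => hg.eq_neg_one _ hy.le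
  -- The tube and the region where `ρ` is constant overlap because `c < ε`, so no smoothness of `δ`
  -- is needed deeper inside `Ω`.
  have hW : closure Ω ⊆ T ∪ {x | MConvex.signedDistance Ω x < -c} := by
    intro x hx
    by_cases hxε : -ε < MConvex.signedDistance Ω x
    · exact Or.inl (hT.mem x (hclos x hx) hxε)
    · exact Or.inr (show MConvex.signedDistance Ω x < -c by linarith)
  have hρ : ContDiffOn ℝ ((k + 1 : ℕ∞) : WithTop ℕ∞) (fun x => g (MConvex.signedDistance Ω x))
      (T ∪ {x | MConvex.signedDistance Ω x < -c}) := by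
    rintro x (hx | hx)
    · refine ContDiffAt.contDiffWithinAt ?_
      refine (hg.contDiff (k + 1)).contDiffAt.comp x ?_
      rw [hcast]
      exact hT.contDiffOn.contDiffAt (hT.isOpen.mem_nhds hx)
    · exact (contDiffAt_const.congr_of_eventuallyEq (hconst x hx)).contDiffWithinAt
  refine ⟨fun x => g (MConvex.signedDistance Ω x),
    ⟨_, hT.isOpen.union (isOpen_lt hδcont continuous_const), hW, hρ⟩,
    fun x hx => hg.zero ▸ hg.monotone (hclos x hx),
    ⟨(hρ.mono (subset_closure.trans hW)).of_le (by rw [hcast]; exact hT.two_le),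
      fun x hx L hL => ?_⟩,
    fun x hx => (congrArg g (MConvex.signedDistance_of_mem_frontier hx)).trans hg.zero,
    fun x hx hx1 _ => ?_, fun t ht ht0 => ?_⟩
  · by_cases hxc : MConvex.signedDistance Ω x < -c
    · exact (MConvex.traceHess_of_eventuallyEq_const (hconst x hxc) L).ge
    · exact hT.traceHess_comp_nonneg hε hn (by omega) (by omega) hΩ_convex (hneg.2 hx)
        (by linarith) hg L hL
  · have hxc := hg.neg_one_lt_iff.1 hx1
    have hxT := hT.mem x (hclos x hx) (by linarith)
    have hd := (hg.hasDerivAt (MConvex.signedDistance Ω x)).comp_hasFDerivAt x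
      ((hT.contDiffAt hxT).differentiableAt (by norm_num)).hasFDerivAt
    have hd' : HasFDerivAt (fun x => g (MConvex.signedDistance Ω x)) _ x := hd
    rw [hd'.fderiv]
    refine smul_ne_zero (hg.deriv_pos _ hxc).ne' ?_
    rw [← norm_ne_zero_iff, hT.norm_fderiv hxT]
    exact one_ne_zero
  · obtain ⟨τ, hτc, hτ0, rfl⟩ := hg.exists_eq hc0 ht ht0
    have hτε : -ε < τ := by linarith
    have hlev : {x | x ∈ closure Ω ∧ g (MConvex.signedDistance Ω x) = g τ} =
        {x | MConvex.signedDistance Ω x = τ} := by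
      ext x
      refine ⟨fun hx => ?_, fun hx => ?_⟩
      · have hxc := hg.neg_one_lt_iff.1 (hx.2.symm ▸ ht)
        exact hg.strictMonoOn.injOn hxc.le hτc.le hx.2
      · replace hx : MConvex.signedDistance Ω x = τ := hx
        exact ⟨subset_closure (hneg.1 (by rwa [hx])), by rw [hx]⟩
    have hD : ∀ y, y ∈ {y | y ∈ Ω ∧ g (MConvex.signedDistance Ω y) < g τ} ↔
        MConvex.signedDistance Ω y < τ := fun y =>
      ⟨fun hy => (hg.lt_iff hτc).1 hy.2, fun hy => ⟨hneg.1 (hy.trans hτ0), (hg.lt_iff hτc).2 hy⟩⟩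
    have hmem : ∀ x ∈ closure Ω, g (MConvex.signedDistance Ω x) = g τ →
        MConvex.signedDistance Ω x = τ := fun x hx hxt => by
      have : x ∈ {x | MConvex.signedDistance Ω x = τ} := hlev ▸ ⟨hx, hxt⟩
      exact this
    refine ⟨⟨τ, hτε, hτ0, hlev⟩, hlev.trans (hT.frontier_sublevel hτ0.le hτε hD).symm,
      fun x hx hxt => ?_, fun x hx hxt hfl => ?_,
      hT.notMFlatAtInfinity_sublevel hε hn hΩ_flat hτ0 hτε hD⟩
    · have hxτ := hmem x hx hxt
      exact hT.isMConvexAt_level hε hn hΩ_convex (by rwa [hxτ]) (by rwa [hxτ]) (by rwa [hxτ])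
    · have hxτ := hmem x hx hxt
      exact hT.isStronglyMConvexAt_level hε hn hΩ_convex (by rwa [hxτ]) (by rwa [hxτ])
        (by rwa [hxτ]) hfl
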